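/- Let $S$ be a finite set, $Q$ an integral matrix whose columns are indexed by $S$, and $p$ an integral vector. A rational system $Ax\ge b$ is totally dual integral (TDI) if, for every integral vector $c$ for which $\max\{yb : y\ge 0,\ yA=c\}$ is finite, this maximum is attained at an integral $y$; it is box-TDI if $[Ax\ge b,\ f\le x\le g]$ is TDI for all rational (finite) vectors $f\le g$. Let $Qx\ge p$ be a box-TDI system, suppose that $R=\{x\in\mathbf R^S: Qx\ge p\}$ is an integral polyhedron (the convex hull of its integral elements), and let $z_0\in R\cap\mathbf Z^S$. Let $Q_0$ consist of the rows ${}_iq$ of $Q$ with ${}_iq\,z_0=p(i)$, and put $$C_0=\{x\in\mathbf R^S: Q_0x\ge 0\},\qquad C_0^*=\{y_0Q_0 : y_0\ge 0\}.$$ For each $s\in S$ let $\varphi_s:\mathbf Z\to\mathbf Z\cup\{+\infty\}$ be discrete convex, that is, $\{k:\varphi_s(k)<+\infty\}$ is the set of integers of a (possibly unbounded) interval, and $\varphi_s(k-1)+\varphi_s(k+1)\ge 2\varphi_s(k)$ for every $k$ in this set. Put $$\Phi(w)=\sum_{s\in S}\varphi_s(w(s)),\qquad \Phi^\bullet(z)=\sum_{s\in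 S}\varphi_s^\bullet(z(s)),\qquad \varphi_s^\bullet(l)=\sup_{k\in\mathbf Z}\,(kl-\varphi_s(k))$$ for $w,z\in\mathbf Z^S$. A pair $(w,z)$ of vectors in $\mathbf Z^S$ is called $\Phi$-fitting if, for every $s\in S$, $\varphi_s(w(s))$ is finite and $$\varphi_s(w(s))-\varphi_s(w(s)-1)\le z(s)\le\varphi_s(w(s)+1)-\varphi_s(w(s)).$$ For a vector $w$ and a set $X$, an element $z_0\in X$ is a $w$-minimizer of $X$ if $wz_0\le wx$ for all $x\in X$. Suppose that there is a $w\in\mathbf Z^S$ for which $z_0$ is a $w$-minimizer of $R\cap\mathbf Z^S$ and $\Phi(w)<+\infty$. Then $$\begin{aligned}&\min\{\Phi(w): w\in\mathbf Z^S,\ z_0\text{ is a }w\text{-minimizer of }R\cap\mathbf Z^S\}\\&=\max\{\Phi(w)-zw: w\in C_0^*\cap\mathbf Z^S,\ z\in C_0\cap\mathbf Z^S,\ (w,z)\ \Phi\text{-fitting}\}\\&=\max\{-\Phi^\bullet(z): z\in C_0\cap\mathbf Z^S\}.\end{aligned}$$ More precisely, $\Phi$ is bounded from below on the set of the vectors $w$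 in the first line if and only if there is a pair $(w,z)$ as in the second line. If $\Phi$ is bounded from below on that set, then the minimum and both maxima are attained and equal the same integer. In general, the equalities hold in $\mathbf R\cup\{\pm\infty\}$ with infimum and suprema, where $\sup\emptyset=-\infty$. Moreover, a vector $w^*\in\mathbf Z^S$ for which $z_0$ is a $w^*$-minimizer of $R$ minimizes $\Phi$ over the set of the vectors $w$ in the first line if and only if there is a $z^*\in C_0\cap\mathbf Z^S$ such that $w^*z^*=0$ and $(w^*,z^*)$ is $\Phi$-fitting. -/

import Mathlib

open scoped Matrix

namespace BoxTDI

section Polyhedra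

variable {m S : Type*} [Fintype m] [Fintype S]

/-- An integral vector, viewed as a real vector. -/
def realVec {ι : Type*} (z : ι → ℤ) : ι → ℝ := fun i => (z i : ℝ)

/-- The polyhedron `{x : Qx ≥ p}` in `ℝ^S` of an integral matrix `Q` and an integral vector `p`. -/
def polyhedron (Q : Matrix m S ℤ) (p : m → ℤ) : Set (S → ℝ) :=
  {x | ∀ i, (p i : ℝ) ≤ (Q.map (Int.cast : ℤ → ℝ) *ᵥ x) i}

/-- The integral elements of a subset of `ℝ^S`. -/
def latticePoints (R : Set (S → ℝ)) : Set (S → ℝ) :=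
  R ∩ Set.range (realVec : (S → ℤ) → S → ℝ)

/-- A polyhedron is integral if it is the convex hull of its integral elements. -/
def IsIntegralPolyhedron (R : Set (S → ℝ)) : Prop :=
  R = convexHull ℝ (latticePoints R)

/-- `z` is a `w`-minimizer of `X`. -/
def IsMinimizer (w : S → ℝ) (X : Set (S → ℝ)) (z : S → ℝ) : Prop :=
  z ∈ X ∧ ∀ x ∈ X, w ⬝ᵥ z ≤ w ⬝ᵥ x

/-- The feasible set `{y : y ≥ 0, yA = c}` of the linear program
`max {yb : y ≥ 0, yA = c}`, which is dual to `min {cx : Ax ≥ b}`. -/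
def dualFeasible (A : Matrix m S ℚ) (c : S → ℤ) : Set (m → ℝ) :=
  {y | 0 ≤ y ∧ y ᵥ* A.map (Rat.cast : ℚ → ℝ) = realVec c}

/-- The rational system `Ax ≥ b` is totally dual integral: for every integral `c` for which
`max {yb : y ≥ 0, yA = c}` is finite (feasible and bounded from above), this maximum, taken over
real vectors, is attained at an integral vector. -/
def IsTDI (A : Matrix m S ℚ) (b : m → ℚ) : Prop :=
  ∀ c : S → ℤ, (dualFeasible A c).Nonempty →
    BddAbove ((fun y : m → ℝ => y ⬝ᵥ fun i => (b i : ℝ)) '' dualFeasible A c) →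
    ∃ y : m → ℤ, realVec y ∈ dualFeasible A c ∧
      ∀ y' ∈ dualFeasible A c, (y' ⬝ᵥ fun i => (b i : ℝ)) ≤ realVec y ⬝ᵥ fun i => (b i : ℝ)

/-- The system `Ax ≥ b` is box-TDI: for all rational (finite) bounds `f ≤ g`, the system
`[Ax ≥ b, x ≥ f, -x ≥ -g]` is TDI. -/
def IsBoxTDI [DecidableEq S] (A : Matrix m S ℚ) (b : m → ℚ) : Prop :=
  ∀ f g : S → ℚ, f ≤ g →
    IsTDI (Matrix.fromRows A (Matrix.fromRows (1 : Matrix S S ℚ) (-1 : Matrix S S ℚ)))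
      (Sum.elim b (Sum.elim f (-g)))

/-- The submatrix of the rows of `Q` whose inequality in `Qx ≥ p` holds with equality at `z₀`. -/
def tightRows (Q : Matrix m S ℤ) (p : m → ℤ) (z₀ : S → ℤ) :
    Matrix {i : m // (Q *ᵥ z₀) i = p i} S ℤ :=
  Q.submatrix Subtype.val id

/-- The cone `{x : Kx ≥ 0}`. -/
def cone (K : Matrix m S ℤ) : Set (S → ℝ) :=
  {x | 0 ≤ K.map (Int.cast : ℤ → ℝ) *ᵥ x}

/-- The dual cone `{w : w = yK, y ≥ 0}` of `{x : Kx ≥ 0}`. -/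
def dualCone (K : Matrix m S ℤ) : Set (S → ℝ) :=
  {w | ∃ y : m → ℝ, 0 ≤ y ∧ w = y ᵥ* K.map (Int.cast : ℤ → ℝ)}

end Polyhedra

section Convex

/-- A function `φ : ℤ → ℤ ∪ {+∞}` is discrete convex: its effective domain is the set of integers
of an interval, and `φ (k - 1) + φ (k + 1) ≥ 2 φ k` for every `k` in the effective domain. -/
def IsDiscreteConvex (φ : ℤ → WithTop ℤ) : Prop :=
  {k : ℤ | φ k ≠ ⊤}.OrdConnected ∧
    ∀ k : ℤ, φ k ≠ ⊤ → φ k + φ k ≤ φ (k - 1) + φ (k + 1)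

/-- The inclusion of `ℤ ∪ {+∞}` into the extended reals. -/
noncomputable def toEReal : WithTop ℤ → EReal
  | ⊤ => ⊤
  | (n : ℤ) => ((n : ℝ) : EReal)

/-- The discrete conjugate `φ• (l) = sup {k l - φ k : k ∈ ℤ}`. -/
noncomputable def conj (φ : ℤ → WithTop ℤ) (l : ℤ) : EReal :=
  ⨆ k : ℤ, (((k * l : ℤ) : ℝ) : EReal) - toEReal (φ k)

/-- The pair `(k, l)` is `φ`-fitting: `φ k - φ (k - 1) ≤ l ≤ φ (k + 1) - φ k`. These differences
are meaningful only for finite `φ k`; then they lie in `ℤ ∪ {-∞}` and in `ℤ ∪ {+∞}`, and the two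
inequalities are written without subtraction. -/
def IsFitting (φ : ℤ → WithTop ℤ) (k l : ℤ) : Prop :=
  φ k ≠ ⊤ ∧ φ k ≤ (l : WithTop ℤ) + φ (k - 1) ∧ (l : WithTop ℤ) + φ k ≤ φ (k + 1)

variable {S : Type*} [Fintype S]

/-- The separable function `Φ w = ∑ s, φ s (w s)`. -/
def sepFun (φ : S → ℤ → WithTop ℤ) (w : S → ℤ) : WithTop ℤ := ∑ s, φ s (w s)

/-- The discrete conjugate `Φ• z = ∑ s, (φ s)• (z s)` of the separable function. -/
noncomputable def sepConj (φ : S → ℤ → WithTop ℤ) (z : S → ℤ) : EReal := ∑ s, conj (φ s) (z s)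

/-- The ordered pair `(w, z)` is `Φ`-fitting. -/
def IsSepFitting (φ : S → ℤ → WithTop ℤ) (w z : S → ℤ) : Prop :=
  ∀ s, IsFitting (φ s) (w s) (z s)

end Convex

section Inverse

variable {m S : Type*} [Fintype m] [Fintype S]

/-- The integral cost-vectors `w` for which `z₀` is a `w`-minimizer of the set of integral elements
of the polyhedron. -/
def inverseCosts (Q : Matrix m S ℤ) (p : m → ℤ) (z₀ : S → ℤ) : Set (S → ℤ) :=
  {w | IsMinimizer (realVec w) (latticePoints (polyhedron Q p)) (realVec z₀)}

/-- The cone `C₀ = {x : Q₀ x ≥ 0}` of the constraints that are tight at `z₀`. -/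
def tightCone (Q : Matrix m S ℤ) (p : m → ℤ) (z₀ : S → ℤ) : Set (S → ℝ) :=
  cone (tightRows Q p z₀)

/-- The dual cone `{w : w = y₀ Q₀, y₀ ≥ 0}` of `C₀`. -/
def tightDualCone (Q : Matrix m S ℤ) (p : m → ℤ) (z₀ : S → ℤ) : Set (S → ℝ) :=
  dualCone (tightRows Q p z₀)

/-- The pairs `(w, z)` of integral vectors with `w` in the dual cone of `C₀`, with `z` in `C₀`,
and such that `(w, z)` is `Φ`-fitting. -/
def fittingPairs (Q : Matrix m S ℤ) (p : m → ℤ) (z₀ : S → ℤ) (φ : S → ℤ → WithTop ℤ) :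
    Set ((S → ℤ) × (S → ℤ)) :=
  {wz | realVec wz.1 ∈ tightDualCone Q p z₀ ∧ realVec wz.2 ∈ tightCone Q p z₀ ∧
    IsSepFitting φ wz.1 wz.2}

/-- The objective values `Φ w` of the minimization problem. -/
def primalValues (Q : Matrix m S ℤ) (p : m → ℤ) (z₀ : S → ℤ) (φ : S → ℤ → WithTop ℤ) :
    Set EReal :=
  {v | ∃ w ∈ inverseCosts Q p z₀, v = toEReal (sepFun φ w)}

/-- The objective values `Φ w - z w` of the maximization over fitting pairs. -/
def fittingValues (Q : Matrix m S ℤ) (p : m → ℤ) (z₀ : S → ℤ) (φ : S → ℤ → WithTop ℤ) :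
    Set EReal :=
  {v | ∃ wz ∈ fittingPairs Q p z₀ φ,
    v = toEReal (sepFun φ wz.1) - (((wz.2 ⬝ᵥ wz.1 : ℤ) : ℝ) : EReal)}

/-- The objective values `-Φ• z` of the maximization over the integral elements of `C₀`. -/
def conjValues (Q : Matrix m S ℤ) (p : m → ℤ) (z₀ : S → ℤ) (φ : S → ℤ → WithTop ℤ) :
    Set EReal :=
  {v | ∃ z : S → ℤ, realVec z ∈ tightCone Q p z₀ ∧ v = -sepConj φ z}

end Inverse

end BoxTDI

open BoxTDI

/-! Since R is the convex hull of its lattice points, minimizing over these points is minimizing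
over R, and by Farkas' lemma z₀ is a w-minimizer exactly when w lies in C₀*
(`mem_inverseCosts_iff`). The task is thus to minimize a separable discrete convex Φ over the
integral vectors of a polyhedral cone.

Weak duality is Fenchel's inequality together with zw ≥ 0 for z in C₀ and w in C₀*: -Φ•(z) ≤ Φ(w) -
zw ≤ Φ(w). A fitting pair is a discrete subgradient (`IsFitting.add_mul_le`), so it gives equality
on the left, and wz = 0 gives it on the right. Everything therefore rests on finding, at an integral
minimizer w, an integral z in C₀ with wz = 0 and (w, z) fitting
(`exists_isSepFitting_of_forall_sepFun_le`). A minimizer exists in the bounded case because finite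
values of Φ are integers; in the unbounded case weak duality forces both suprema to -∞.

Fitting means that z lies between the left and right slopes of Φ at w. By a theorem of the
alternative, either a real z of this kind exists, or w can be moved inside C₀*, by at most 1 in each
coordinate, so that the linearization of Φ decreases. Box-total dual integrality makes both outcomes
integral. It passes to the tight rows (`isBoxTDI_tightRows`), and then the vertices of C₀ cut by an
integral box are integral (`exists_integral_mem_cone`), and so are those of C₀* cut by an integral
box (`extremePoint_integral_dualCone`). The first outcome becomes the required z; the second becomes
an integral vector with a smaller Φ, a contradiction. -/

namespace BoxTDI

/-! ### Farkas' lemma over an ordered field (needed for both ℚ and ℝ) -/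

/-- Farkas' lemma for finitely many linear functionals over an ordered field. -/
theorem farkas {𝕜 V ι : Type*} [Field 𝕜] [LinearOrder 𝕜] [IsStrictOrderedRing 𝕜]
    [AddCommGroup V] [Module 𝕜 V] [DecidableEq ι] (t : Finset ι) :
    ∀ (a : ι → V →ₗ[𝕜] 𝕜) (c : V →ₗ[𝕜] 𝕜),
      (∀ x, (∀ i ∈ t, 0 ≤ a i x) → 0 ≤ c x) →
      ∃ y : ι → 𝕜, 0 ≤ y ∧ c = ∑ i ∈ t, y i • a i := by
  induction t using Finset.induction_on with
  | empty =>
    intro a c h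
    refine ⟨0, le_rfl, LinearMap.ext fun x => ?_⟩
    have h₁ := h x (by simp)
    have h₂ := h (-x) (by simp)
    rw [map_neg] at h₂
    simpa using le_antisymm (by linarith) h₁
  | insert k t hk ih =>
    intro a c h
    by_cases hc : ∀ x, (∀ i ∈ t, 0 ≤ a i x) → 0 ≤ c x
    · obtain ⟨y, hy, hcy⟩ := ih a c hc
      refine ⟨fun i => if i = k then 0 else y i, fun i => ?_, ?_⟩
      · dsimp only
        split_ifs
        exacts [le_rfl, hy i]
      · rw [Finset.sum_insert hk, hcy]
        simp only [if_true, zero_smul, zero_add]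
        refine Finset.sum_congr rfl fun i hi => ?_
        rw [if_neg]
        rintro rfl
        exact hk hi
    · push Not at hc
      obtain ⟨x₁, hx₁, hcx₁⟩ := hc
      have hk₁ : a k x₁ < 0 := by
        by_contra! hcon
        refine absurd (h x₁ fun i hi => ?_) (not_le.2 hcx₁)
        rcases Finset.mem_insert.1 hi with rfl | hi
        exacts [hcon, hx₁ i hi]
      obtain ⟨x₀, hx₀, hcx₀, hk₀⟩ :
          ∃ x₀, (∀ i ∈ t, 0 ≤ a i x₀) ∧ c x₀ < 0 ∧ a k x₀ = -1 := by
        have hpos : 0 < (-a k x₁)⁻¹ := inv_pos.2 (neg_pos.2 hk₁)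
        refine ⟨(-a k x₁)⁻¹ • x₁, fun i hi => ?_, ?_, ?_⟩
        · simpa using mul_nonneg hpos.le (hx₁ i hi)
        · simpa only [map_smul, smul_eq_mul] using mul_neg_of_pos_of_neg hpos hcx₁
        · rw [map_smul, smul_eq_mul, inv_neg, neg_mul, inv_mul_cancel₀ hk₁.ne]
      -- As `a k x₀ = -1`, the map `x ↦ x + a k x • x₀` projects onto the kernel of `a k`; the
      -- induction hypothesis is applied to the functionals composed with it.
      obtain ⟨y, hy, hcy⟩ := ih (fun i => a i + a i x₀ • a k) (c + c x₀ • a k) (by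
        intro x hx
        have := h (x + a k x • x₀) (by
          intro i hi
          rcases Finset.mem_insert.1 hi with rfl | hi
          · simp [hk₀]
          · have := hx i hi
            simp only [LinearMap.add_apply, LinearMap.smul_apply, smul_eq_mul, map_add,
              map_smul] at this ⊢
            linarith [mul_comm (a i x₀) (a k x)])
        simp only [LinearMap.add_apply, LinearMap.smul_apply, smul_eq_mul, map_add,
          map_smul] at this ⊢
        linarith [mul_comm (c x₀) (a k x)])
      refine ⟨fun i => if i = k then ∑ j ∈ t, y j * a j x₀ - c x₀ else y i, fun i => ?_, ?_⟩
      · dsimp only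
        split_ifs
        · have : 0 ≤ ∑ j ∈ t, y j * a j x₀ :=
            Finset.sum_nonneg fun j hj => mul_nonneg (hy j) (hx₀ j hj)
          simp only [Pi.zero_apply]
          linarith
        · exact hy i
      · rw [Finset.sum_insert hk]
        have : ∑ i ∈ t, (if i = k then ∑ j ∈ t, y j * a j x₀ - c x₀ else y i) • a i =
            ∑ i ∈ t, y i • a i := by
          refine Finset.sum_congr rfl fun i hi => ?_
          rw [if_neg]
          rintro rfl
          exact hk hi
        rw [this]
        simp only [if_true]
        have h₂ : ∑ i ∈ t, y i • (a i + a i x₀ • a k) =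
            ∑ i ∈ t, y i • a i + (∑ j ∈ t, y j * a j x₀) • a k := by
          simp only [smul_add, Finset.sum_add_distrib, Finset.sum_smul, smul_smul]
        rw [h₂] at hcy
        ext x
        have hx := LinearMap.congr_fun hcy x
        simp only [LinearMap.add_apply, LinearMap.smul_apply, smul_eq_mul, sub_mul] at hx ⊢
        linarith

/-- Farkas' lemma in matrix form. -/
theorem farkas_matrix {𝕜 m S : Type*} [Field 𝕜] [LinearOrder 𝕜] [IsStrictOrderedRing 𝕜]
    [Fintype m] [Fintype S] (K : Matrix m S 𝕜) (c : S → 𝕜)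
    (h : ∀ x, 0 ≤ K *ᵥ x → 0 ≤ c ⬝ᵥ x) : ∃ y : m → 𝕜, 0 ≤ y ∧ c = y ᵥ* K := by
  classical
  obtain ⟨y, hy, hcy⟩ := farkas Finset.univ (fun i => (LinearMap.proj i).comp K.mulVecLin)
    (dotProductBilin 𝕜 𝕜 c) (fun x hx => h x fun i => hx i (Finset.mem_univ i))
  refine ⟨y, hy, funext fun s => ?_⟩
  have := LinearMap.congr_fun hcy (Pi.single s 1)
  simpa [Matrix.vecMul, dotProduct, Pi.single_apply] using this

/-! ### Polyhedral cones and their duals -/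

section Cones

variable {m S : Type*} [Fintype m] [Fintype S]

theorem mem_cone_iff {K : Matrix m S ℤ} {x : S → ℝ} :
    x ∈ cone K ↔ ∀ i, 0 ≤ ∑ s, (K i s : ℝ) * x s := Iff.rfl

theorem dotProduct_nonneg_of_mem_dualCone {K : Matrix m S ℤ} {w x : S → ℝ}
    (hw : w ∈ dualCone K) (hx : x ∈ cone K) : 0 ≤ w ⬝ᵥ x := by
  obtain ⟨y, hy, rfl⟩ := hw
  rw [← Matrix.dotProduct_mulVec]
  exact dotProduct_nonneg_of_nonneg hy hx

/-- Farkas' lemma turns the finitely generated cone into an intersection of half-spaces, from which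
closedness and stability under the cone operations can be read off. -/
theorem mem_dualCone_iff {K : Matrix m S ℤ} {w : S → ℝ} :
    w ∈ dualCone K ↔ ∀ x ∈ cone K, 0 ≤ w ⬝ᵥ x :=
  ⟨fun hw _ hx => dotProduct_nonneg_of_mem_dualCone hw hx, fun h => farkas_matrix _ w h⟩

theorem isClosed_dualCone (K : Matrix m S ℤ) : IsClosed (dualCone K) := by
  have : dualCone K = ⋂ x ∈ cone K, {w : S → ℝ | 0 ≤ w ⬝ᵥ x} := by
    ext w
    simp [mem_dualCone_iff]
  rw [this]
  refine isClosed_biInter fun x _ => isClosed_le continuous_const ?_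
  unfold dotProduct
  fun_prop

theorem isClosed_cone (K : Matrix m S ℤ) : IsClosed (cone K) := by
  have : cone K = ⋂ i, {x : S → ℝ | 0 ≤ ∑ s, (K i s : ℝ) * x s} := by
    ext x
    simp [mem_cone_iff]
  rw [this]
  refine isClosed_iInter fun i => isClosed_le continuous_const ?_
  fun_prop

theorem add_mem_dualCone {K : Matrix m S ℤ} {v w : S → ℝ} (hv : v ∈ dualCone K)
    (hw : w ∈ dualCone K) : v + w ∈ dualCone K := by
  rw [mem_dualCone_iff] at *
  intro x hx
  rw [add_dotProduct]
  exact add_nonneg (hv x hx) (hw x hx)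

theorem smul_mem_dualCone {K : Matrix m S ℤ} {v : S → ℝ} {r : ℝ} (hr : 0 ≤ r)
    (hv : v ∈ dualCone K) : r • v ∈ dualCone K := by
  rw [mem_dualCone_iff] at *
  intro x hx
  rw [smul_dotProduct]
  exact mul_nonneg hr (hv x hx)

theorem realVec_dotProduct (w z : S → ℤ) : realVec w ⬝ᵥ realVec z = ((w ⬝ᵥ z : ℤ) : ℝ) := by
  simp [dotProduct, realVec]

end Cones

/-! ### Inverse cost vectors and the cone of the tight constraints -/

section InverseCosts

variable {m S : Type*} [Fintype m] [Fintype S] {Q : Matrix m S ℤ} {p : m → ℤ} {z₀ : S → ℤ}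

theorem mem_polyhedron_iff {x : S → ℝ} :
    x ∈ polyhedron Q p ↔ ∀ i, (p i : ℝ) ≤ ∑ s, (Q i s : ℝ) * x s := Iff.rfl

theorem mem_tightCone_iff {x : S → ℝ} :
    x ∈ tightCone Q p z₀ ↔ ∀ i, (Q *ᵥ z₀) i = p i → 0 ≤ ∑ s, (Q i s : ℝ) * x s :=
  Subtype.forall

theorem cast_mulVec_apply (i : m) :
    (((Q *ᵥ z₀) i : ℤ) : ℝ) = ∑ s, (Q i s : ℝ) * realVec z₀ s := by
  simp [Matrix.mulVec, dotProduct, realVec]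

theorem sub_mem_tightCone {x : S → ℝ} (hx : x ∈ polyhedron Q p) :
    x - realVec z₀ ∈ tightCone Q p z₀ := by
  refine mem_tightCone_iff.2 fun i hi => ?_
  have h₁ := mem_polyhedron_iff.1 hx i
  rw [← hi, cast_mulVec_apply] at h₁
  simp only [Pi.sub_apply, mul_sub, Finset.sum_sub_distrib]
  linarith

/-- A small step in a direction that is feasible for the tight constraints stays in the
polyhedron. -/
theorem exists_add_smul_mem_polyhedron {x d : S → ℝ} (hx : x ∈ polyhedron Q p)
    (hd : ∀ i, ∑ s, (Q i s : ℝ) * x s = p i → 0 ≤ ∑ s, (Q i s : ℝ) * d s) :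
    ∃ ε : ℝ, 0 < ε ∧ ∀ δ, 0 < δ → δ ≤ ε → x + δ • d ∈ polyhedron Q p := by
  have key : ∀ i, ∃ ε : ℝ, 0 < ε ∧ ∀ δ, 0 < δ → δ ≤ ε →
      (p i : ℝ) ≤ ∑ s, (Q i s : ℝ) * (x s + δ * d s) := by
    intro i
    have hsum : ∀ δ : ℝ, ∑ s, (Q i s : ℝ) * (x s + δ * d s) =
        ∑ s, (Q i s : ℝ) * x s + δ * ∑ s, (Q i s : ℝ) * d s := by
      intro δ
      rw [Finset.mul_sum, ← Finset.sum_add_distrib]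
      exact Finset.sum_congr rfl fun s _ => by ring
    rcases (mem_polyhedron_iff.1 hx i).eq_or_lt with hi | hi
    · refine ⟨1, one_pos, fun δ hδ _ => ?_⟩
      rw [hsum, ← hi]
      exact le_add_of_nonneg_right (mul_nonneg hδ.le (hd i hi.symm))
    · set A := ∑ s, (Q i s : ℝ) * d s
      have hA : 0 < |A| + 1 := by positivity
      refine ⟨(∑ s, (Q i s : ℝ) * x s - p i) / (|A| + 1),
        div_pos (sub_pos.2 hi) hA, fun δ hδ hδ' => ?_⟩
      rw [hsum]
      rw [le_div_iff₀ hA] at hδ'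
      nlinarith [neg_abs_le A]
  choose ε hε hkey using key
  obtain ⟨δ, hδ, hδε⟩ : ∃ δ : ℝ, 0 < δ ∧ ∀ i, δ ≤ ε i := by
    rcases isEmpty_or_nonempty m with h | h
    · exact ⟨1, one_pos, fun i => (h.false i).elim⟩
    · obtain ⟨i, hi⟩ := Finite.exists_min ε
      exact ⟨ε i, hε i, hi⟩
  exact ⟨δ, hδ, fun η hη hηδ i => hkey i η hη (hηδ.trans (hδε i))⟩

/-- From z₀, a short step along any direction in C₀ stays in the polyhedron, so minimality makes w
nonnegative on C₀; Farkas' lemma does the rest. -/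
theorem mem_tightDualCone_of_isMinimizer (hz₀ : realVec z₀ ∈ polyhedron Q p) {w : S → ℝ}
    (hw : IsMinimizer w (polyhedron Q p) (realVec z₀)) : w ∈ tightDualCone Q p z₀ := by
  refine mem_dualCone_iff.2 fun x hx => ?_
  obtain ⟨ε, hε, hmem⟩ := exists_add_smul_mem_polyhedron hz₀ fun i hi =>
    mem_tightCone_iff.1 hx i (by rw [← cast_mulVec_apply] at hi; exact_mod_cast hi)
  have := hw.2 _ (hmem ε hε le_rfl)
  rw [dotProduct_add, dotProduct_smul, smul_eq_mul] at this
  exact nonneg_of_mul_nonneg_right (by linarith) hε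

theorem isMinimizer_of_mem_tightDualCone (hz₀ : realVec z₀ ∈ polyhedron Q p) {w : S → ℝ}
    (hw : w ∈ tightDualCone Q p z₀) : IsMinimizer w (polyhedron Q p) (realVec z₀) := by
  refine ⟨hz₀, fun x hx => ?_⟩
  have := dotProduct_nonneg_of_mem_dualCone hw (sub_mem_tightCone hx)
  rw [dotProduct_sub] at this
  linarith

theorem isMinimizer_convexHull {w : S → ℝ} {X : Set (S → ℝ)} {z : S → ℝ}
    (h : IsMinimizer w X z) : IsMinimizer w (convexHull ℝ X) z := by
  refine ⟨subset_convexHull ℝ X h.1, fun x hx => ?_⟩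
  have hconv : Convex ℝ {x : S → ℝ | w ⬝ᵥ z ≤ w ⬝ᵥ x} :=
    convex_halfSpace_ge (f := fun x => w ⬝ᵥ x)
      ⟨fun x y => dotProduct_add w x y, fun c x => dotProduct_smul c w x⟩ _
  exact convexHull_min (fun y hy => h.2 y hy) hconv hx

/-- The inverse cost vectors are the integral elements of the dual of the tight cone. -/
theorem mem_inverseCosts_iff (hint : IsIntegralPolyhedron (polyhedron Q p))
    (hz₀ : realVec z₀ ∈ polyhedron Q p) {w : S → ℤ} :
    w ∈ inverseCosts Q p z₀ ↔ realVec w ∈ tightDualCone Q p z₀ := by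
  constructor
  · intro hw
    have := isMinimizer_convexHull hw
    rw [← hint] at this
    exact mem_tightDualCone_of_isMinimizer hz₀ this
  · intro hw
    obtain ⟨_, h₂⟩ := isMinimizer_of_mem_tightDualCone hz₀ hw
    exact ⟨⟨hz₀, z₀, rfl⟩, fun x hx => h₂ x hx.1⟩

end InverseCosts

/-! ### Integrality of vertices for TDI systems -/

section Vertices

variable {m S : Type*} [Fintype m] [Fintype S]

theorem mem_dualFeasible_iff {A : Matrix m S ℤ} {c : S → ℤ} {y : m → ℝ} :
    y ∈ dualFeasible (A.map (Int.cast : ℤ → ℚ)) c ↔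
      0 ≤ y ∧ y ᵥ* A.map (Int.cast : ℤ → ℝ) = realVec c := by
  have : (A.map (Int.cast : ℤ → ℚ)).map (Rat.cast : ℚ → ℝ) = A.map (Int.cast : ℤ → ℝ) := by
    ext
    simp
  simp only [dualFeasible, this, Set.mem_ofPred_eq]

/-- For a TDI system with integral data, the objective value of a point that satisfies
complementary slackness with some dual solution is an integer. -/
theorem exists_int_eq_dotProduct_of_isTDI {A : Matrix m S ℤ} {b : m → ℤ}
    (h : IsTDI (A.map (Int.cast : ℤ → ℚ)) fun i => (b i : ℚ)) {x : S → ℝ}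
    (hx : x ∈ polyhedron A b) {y : m → ℝ} (hy : 0 ≤ y)
    (hxy : ∀ i, y i ≠ 0 → ∑ s, (A i s : ℝ) * x s = b i) {c : S → ℤ}
    (hc : y ᵥ* A.map (Int.cast : ℤ → ℝ) = realVec c) : ∃ n : ℤ, realVec c ⬝ᵥ x = n := by
  have hle : ∀ y' ∈ dualFeasible (A.map (Int.cast : ℤ → ℚ)) c,
      (y' ⬝ᵥ fun i => ((b i : ℚ) : ℝ)) ≤ realVec c ⬝ᵥ x := by
    intro y' hy'
    rw [mem_dualFeasible_iff] at hy'
    rw [← hy'.2, ← Matrix.dotProduct_mulVec]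
    refine Finset.sum_le_sum fun i _ => mul_le_mul_of_nonneg_left ?_ (hy'.1 i)
    simpa using hx i
  have hmem : y ∈ dualFeasible (A.map (Int.cast : ℤ → ℚ)) c := mem_dualFeasible_iff.2 ⟨hy, hc⟩
  obtain ⟨y₁, hy₁, hmax⟩ := h c ⟨y, hmem⟩ ⟨_, Set.forall_mem_image.2 hle⟩
  have heq : realVec c ⬝ᵥ x = y ⬝ᵥ fun i => ((b i : ℚ) : ℝ) := by
    rw [← hc, ← Matrix.dotProduct_mulVec]
    refine Finset.sum_congr rfl fun i _ => ?_
    by_cases hi : y i = 0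
    · simp [hi]
    · congr 1
      simpa [Matrix.mulVec, dotProduct] using hxy i hi
  refine ⟨y₁ ⬝ᵥ b, ?_⟩
  have h₁ := hle _ hy₁
  have h₂ := hmax y hmem
  rw [← heq] at h₂
  rw [le_antisymm h₂ h₁]
  simp [dotProduct, realVec]

/-- At an extreme point, the tight constraints determine the point. -/
theorem eq_zero_of_tight_of_extremePoint {A : Matrix m S ℤ} {b : m → ℤ} {x d : S → ℝ}
    (hx : x ∈ (polyhedron A b).extremePoints ℝ)
    (hd : ∀ i, ∑ s, (A i s : ℝ) * x s = b i → ∑ s, (A i s : ℝ) * d s = 0) : d = 0 := by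
  obtain ⟨ε₁, hε₁, h₁⟩ := exists_add_smul_mem_polyhedron hx.1 (d := d) fun i hi => (hd i hi).ge
  obtain ⟨ε₂, hε₂, h₂⟩ := exists_add_smul_mem_polyhedron hx.1 (d := -d) fun i hi => by
    simpa using (hd i hi).le
  have hε : 0 < min ε₁ ε₂ := lt_min hε₁ hε₂
  have := hx.2 (h₁ _ hε (min_le_left _ _)) (h₂ _ hε (min_le_right _ _))
    ⟨1 / 2, 1 / 2, by norm_num, by norm_num, by norm_num, by
      ext s
      simp only [Pi.add_apply, Pi.smul_apply, Pi.neg_apply, smul_eq_mul]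
      ring⟩
  have h₃ : min ε₁ ε₂ • d = 0 := by simpa using this
  exact (smul_eq_zero.1 h₃).resolve_left hε.ne'

/-- The extreme points of a polyhedron that is given by a TDI system with integral data are
integral. -/
theorem extremePoint_integral_of_isTDI {A : Matrix m S ℤ} {b : m → ℤ}
    (h : IsTDI (A.map (Int.cast : ℤ → ℚ)) fun i => (b i : ℚ)) {x : S → ℝ}
    (hx : x ∈ (polyhedron A b).extremePoints ℝ) : x ∈ Set.range (realVec : (S → ℤ) → S → ℝ) := by
  classical
  set T : m → Prop := fun i => ∑ s, (A i s : ℝ) * x s = b i with hT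
  -- The tight rows at `x`, the others set to zero. They have full column rank because `x` is
  -- extreme, so row `s` of a left inverse writes the unit vector of `s` as a combination of tight
  -- rows, with coefficients of either sign.
  let B : Matrix m S ℝ := Matrix.of fun i s => if T i then (A i s : ℝ) else 0
  have hinj : Function.Injective B.mulVecLin := by
    rw [← LinearMap.ker_eq_bot, LinearMap.ker_eq_bot']
    intro d hd
    refine eq_zero_of_tight_of_extremePoint hx fun i hi => ?_
    have := congrFun hd i
    have hi' : T i := hi
    simpa [B, Matrix.mulVec, dotProduct, hi'] using this
  obtain ⟨G, hG⟩ := LinearMap.exists_leftInverse_of_injective B.mulVecLin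
    (LinearMap.ker_eq_bot.2 hinj)
  have hGB : LinearMap.toMatrix' G * B = 1 := by
    have := congrArg LinearMap.toMatrix' hG
    rwa [LinearMap.toMatrix'_comp, LinearMap.toMatrix'_id, ← Matrix.toLin'_apply',
      LinearMap.toMatrix'_toLin'] at this
  suffices hint : ∀ s, ∃ n : ℤ, (n : ℝ) = x s by
    choose n hn using hint
    exact ⟨n, funext hn⟩
  intro s
  -- Adding `M` times every tight row makes these coefficients nonnegative. Then `c` and `c` plus
  -- the unit vector of `s` are both integral costs with a dual solution complementary to `x`, so
  -- both have integral values at `x`; their difference is `x s`.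
  obtain ⟨M, hM⟩ : ∃ M : ℕ, ∀ i, |LinearMap.toMatrix' G s i| ≤ M := by
    obtain ⟨M, hM⟩ := exists_nat_ge (∑ i, |LinearMap.toMatrix' G s i|)
    exact ⟨M, fun i => (Finset.single_le_sum (f := fun i => |LinearMap.toMatrix' G s i|)
      (fun j _ => abs_nonneg _) (Finset.mem_univ i)).trans hM⟩
  let c : S → ℤ := fun t => ∑ i, if T i then (M : ℤ) * A i t else 0
  obtain ⟨n₁, hn₁⟩ := exists_int_eq_dotProduct_of_isTDI h hx.1 (c := c)
    (y := fun i => if T i then (M : ℝ) else 0)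
    (fun i => by dsimp only; split_ifs <;> simp)
    (fun i hi => by by_contra hcon; exact hi (if_neg hcon))
    (by
      ext t
      simp [c, realVec, Matrix.vecMul, dotProduct, ite_mul])
  obtain ⟨n₂, hn₂⟩ := exists_int_eq_dotProduct_of_isTDI h hx.1 (c := c + Pi.single s 1)
    (y := fun i => if T i then (M : ℝ) + LinearMap.toMatrix' G s i else 0)
    (fun i => by
      dsimp only
      split_ifs
      · simp only [Pi.zero_apply]
        linarith [hM i, neg_abs_le (LinearMap.toMatrix' G s i)]
      · exact le_rfl)
    (fun i hi => by by_contra hcon; exact hi (if_neg hcon))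
    (by
      ext t
      have hst := congrFun (congrFun hGB s) t
      rw [Matrix.mul_apply, Matrix.one_apply] at hst
      have h₁ : ((Pi.single s (1 : ℤ) : S → ℤ) t : ℝ) = if s = t then 1 else 0 := by
        by_cases hst' : s = t
        · subst hst'
          simp
        · simp [hst', Ne.symm hst']
      simp only [realVec, Pi.add_apply, Int.cast_add, h₁, ← hst, c, Int.cast_sum,
        Matrix.vecMul, dotProduct, ← Finset.sum_add_distrib]
      refine Finset.sum_congr rfl fun i _ => ?_
      by_cases hi : T i <;> simp [B, hi, add_mul])
  refine ⟨n₂ - n₁, ?_⟩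
  have : realVec (c + Pi.single s 1) ⬝ᵥ x = realVec c ⬝ᵥ x + x s := by
    have : realVec (c + Pi.single s 1) = realVec c + Pi.single s 1 := by
      ext t
      by_cases hst : t = s <;> simp [realVec, hst]
    rw [this, add_dotProduct, single_one_dotProduct]
  push_cast
  linarith

/-- A linear function attains its minimum over a compact set at an extreme point. -/
theorem exists_extremePoint_forall_dotProduct_le {X : Set (S → ℝ)} (hX : IsCompact X)
    (hne : X.Nonempty) (c : S → ℝ) : ∃ v ∈ X.extremePoints ℝ, ∀ x ∈ X, c ⬝ᵥ v ≤ c ⬝ᵥ x := by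
  have hcont : Continuous fun x : S → ℝ => c ⬝ᵥ x := by
    unfold dotProduct
    fun_prop
  obtain ⟨x₀, hx₀, hmin⟩ := hX.exists_isMinOn hne hcont.continuousOn
  have hmin' : ∀ x ∈ X, c ⬝ᵥ x₀ ≤ c ⬝ᵥ x := fun x hx => hmin hx
  set F : Set (S → ℝ) := X ∩ {x | c ⬝ᵥ x ≤ c ⬝ᵥ x₀} with hF
  have hFc : IsCompact F := hX.inter_right (isClosed_le hcont continuous_const)
  obtain ⟨v, hv⟩ := hFc.extremePoints_nonempty ⟨x₀, hx₀, le_refl (c ⬝ᵥ x₀)⟩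
  -- The set of minimizers is a face, so an extreme point of it, which exists by compactness, is
  -- extreme in `X`.
  have hext : IsExtreme ℝ X F := by
    refine ⟨Set.inter_subset_left, ?_⟩
    rintro x₁ hx₁ x₂ hx₂ _ hx ⟨a, b, ha, hb, hab, rfl⟩
    refine ⟨hx₁, ?_⟩
    have h₁ := hx.2
    simp only [Set.mem_ofPred_eq, dotProduct_add, dotProduct_smul, smul_eq_mul] at h₁ ⊢
    have h₂ := hmin' x₂ hx₂
    have : a * (c ⬝ᵥ x₁) ≤ a * (c ⬝ᵥ x₀) := by
      have : c ⬝ᵥ x₀ = a * (c ⬝ᵥ x₀) + b * (c ⬝ᵥ x₀) := by rw [← add_mul, hab, one_mul]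
      nlinarith
    exact le_of_mul_le_mul_left this ha
  exact ⟨v, hext.extremePoints_subset_extremePoints hv,
    fun x hx => hv.1.2.trans (hmin' x hx)⟩

/-- Integral points on faces of a box-TDI cone intersected with an integral box. -/
theorem exists_integral_mem_cone [DecidableEq S] {K : Matrix m S ℤ}
    (hK : IsBoxTDI (K.map (Int.cast : ℤ → ℚ)) 0) {f g : S → ℤ} {w x : S → ℝ}
    (hw : w ∈ dualCone K) (hx : x ∈ cone K) (hfx : realVec f ≤ x) (hxg : x ≤ realVec g)
    (hwx : w ⬝ᵥ x = 0) :
    ∃ z : S → ℤ, realVec z ∈ cone K ∧ f ≤ z ∧ z ≤ g ∧ w ⬝ᵥ realVec z = 0 := by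
  set A : Matrix (m ⊕ S ⊕ S) S ℤ := Matrix.fromRows K (Matrix.fromRows 1 (-1)) with hA
  set b : m ⊕ S ⊕ S → ℤ := Sum.elim 0 (Sum.elim f (-g)) with hb
  have hmem : ∀ v, v ∈ polyhedron A b ↔ v ∈ cone K ∩ Set.Icc (realVec f) (realVec g) := by
    intro v
    simp only [mem_polyhedron_iff, Sum.forall, hA, hb, Set.mem_inter_iff, Set.mem_Icc,
      mem_cone_iff, Pi.le_def, realVec]
    simp [Matrix.one_apply]
  have hset : polyhedron A b = cone K ∩ Set.Icc (realVec f) (realVec g) := Set.ext hmem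
  have hTDI : IsTDI (A.map (Int.cast : ℤ → ℚ)) fun i => (b i : ℚ) := by
    have hfg : f ≤ g := fun s => by
      have := (hfx s).trans (hxg s)
      simpa [realVec] using this
    convert hK (fun s => (f s : ℚ)) (fun s => (g s : ℚ)) (fun s => Int.cast_le.2 (hfg s)) using 1
    · ext i s
      rcases i with i | i | i <;> simp [hA, Matrix.one_apply]
    · ext i
      rcases i with i | i | i <;> simp [hb]
  have hcomp : IsCompact (polyhedron A b) := by
    rw [hset]
    exact isCompact_Icc.inter_left (isClosed_cone K)
  -- On the cone `w` is nonnegative, and `x` attains 0; hence a vertex minimizing `w` stays on the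
  -- face orthogonal to `w`.
  obtain ⟨v, hv, hmin⟩ := exists_extremePoint_forall_dotProduct_le hcomp
    ⟨x, (hmem x).2 ⟨hx, hfx, hxg⟩⟩ w
  obtain ⟨z, rfl⟩ := extremePoint_integral_of_isTDI hTDI hv
  obtain ⟨hzK, hfz, hzg⟩ := (hmem _).1 hv.1
  refine ⟨z, hzK, fun s => by simpa [realVec] using hfz s, fun s => by simpa [realVec] using hzg s,
    le_antisymm ?_ (dotProduct_nonneg_of_mem_dualCone hw hzK)⟩
  rw [← hwx]
  exact hmin x ((hmem x).2 ⟨hx, hfx, hxg⟩)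

end Vertices

/-! ### Explicit dual variables for a system with box constraints -/

section BoxDual

variable {m S : Type*} [Fintype m] [Fintype S]

/-- The feasible solutions of the dual of `min {cx : Kx ≥ b, f ≤ x ≤ g}`. -/
def IsBoxDual (K : Matrix m S ℤ) (c : S → ℤ) (y : m → ℝ) (α β : S → ℝ) : Prop :=
  0 ≤ y ∧ 0 ≤ α ∧ 0 ≤ β ∧ ∀ s, ∑ i, y i * (K i s : ℝ) + α s - β s = c s

/-- The objective function of the dual of `min {cx : Kx ≥ b, f ≤ x ≤ g}`. -/
def boxValue (b : m → ℚ) (f g : S → ℚ) (y : m → ℝ) (α β : S → ℝ) : ℝ :=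
  ∑ i, y i * (b i : ℝ) + ∑ s, (α s * (f s : ℝ) - β s * (g s : ℝ))

theorem elim_mem_dualFeasible_iff [DecidableEq S] {K : Matrix m S ℤ} {c : S → ℤ} {y : m → ℝ}
    {α β : S → ℝ} :
    Sum.elim y (Sum.elim α β) ∈ dualFeasible (Matrix.fromRows (K.map (Int.cast : ℤ → ℚ))
      (Matrix.fromRows (1 : Matrix S S ℚ) (-1 : Matrix S S ℚ))) c ↔ IsBoxDual K c y α β := by
  have h₀ : (0 : m ⊕ S ⊕ S → ℝ) ≤ Sum.elim y (Sum.elim α β) ↔ 0 ≤ y ∧ 0 ≤ α ∧ 0 ≤ β := by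
    simp [Pi.le_def]
  rw [dualFeasible, Set.mem_ofPred_eq, h₀, IsBoxDual, and_assoc, and_assoc, funext_iff]
  have h₁ : ∀ s, (Sum.elim y (Sum.elim α β) ᵥ* (Matrix.fromRows (K.map (Int.cast : ℤ → ℚ))
      (Matrix.fromRows (1 : Matrix S S ℚ) (-1 : Matrix S S ℚ))).map (Rat.cast : ℚ → ℝ)) s =
      ∑ i, y i * (K i s : ℝ) + α s - β s := by
    intro s
    simp only [Matrix.vecMul, dotProduct, Fintype.sum_sum_type, Sum.elim_inl, Sum.elim_inr,
      Matrix.map_apply, Matrix.fromRows_apply_inl, Matrix.fromRows_apply_inr, Rat.cast_intCast,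
      Matrix.one_apply, Matrix.neg_apply, Rat.cast_neg, mul_neg, Finset.sum_neg_distrib]
    simp only [apply_ite (Rat.cast : ℚ → ℝ), Rat.cast_one, Rat.cast_zero, mul_ite, mul_one,
      mul_zero, Finset.sum_ite_eq', Finset.mem_univ, if_true]
    ring
  simp only [h₁, realVec]

theorem elim_dotProduct_eq_boxValue {b : m → ℚ} {f g : S → ℚ} {y : m → ℝ} {α β : S → ℝ} :
    (Sum.elim y (Sum.elim α β) ⬝ᵥ fun i => ((Sum.elim b (Sum.elim f (-g)) i : ℚ) : ℝ)) =
      boxValue b f g y α β := by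
  simp only [dotProduct, Fintype.sum_sum_type, Sum.elim_inl, Sum.elim_inr, boxValue,
    Pi.neg_apply, Rat.cast_neg, mul_neg, Finset.sum_sub_distrib, Finset.sum_neg_distrib]
  ring

theorem sum_elim_surj {X : Type*} (Y : m ⊕ S ⊕ S → X) :
    ∃ y α β, Y = Sum.elim y (Sum.elim α β) :=
  ⟨_, _, _, by
    rw [← Sum.elim_comp_inl_inr Y, ← Sum.elim_comp_inl_inr (Y ∘ Sum.inr)]⟩

theorem realVec_elim (y : m → ℤ) (α β : S → ℤ) :
    realVec (Sum.elim y (Sum.elim α β)) =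
      Sum.elim (realVec y) (Sum.elim (realVec α) (realVec β)) := by
  ext i
  rcases i with i | i | i <;> rfl

/-- Box-total dual integrality in terms of the three groups of dual variables. -/
theorem isBoxTDI_iff [DecidableEq S] {K : Matrix m S ℤ} {b : m → ℚ} :
    IsBoxTDI (K.map (Int.cast : ℤ → ℚ)) b ↔ ∀ f g : S → ℚ, f ≤ g → ∀ (c : S → ℤ) (B : ℝ),
      (∀ y α β, IsBoxDual K c y α β → boxValue b f g y α β ≤ B) →
      ∃ (y : m → ℤ) (α β : S → ℤ), IsBoxDual K c (realVec y) (realVec α) (realVec β) ∧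
        ∀ y' α' β', IsBoxDual K c y' α' β' →
          boxValue b f g y' α' β' ≤ boxValue b f g (realVec y) (realVec α) (realVec β) := by
  refine forall_congr' fun f => forall_congr' fun g => imp_congr_right fun _ =>
    forall_congr' fun c => ?_
  constructor
  · intro h B hB
    -- The box rows alone represent every cost, through its positive and negative parts; only
    -- boundedness remains as a hypothesis.
    have hne : (dualFeasible (Matrix.fromRows (K.map (Int.cast : ℤ → ℚ))
        (Matrix.fromRows (1 : Matrix S S ℚ) (-1 : Matrix S S ℚ))) c).Nonempty := by
      refine ⟨Sum.elim 0 (Sum.elim (fun s => max (c s : ℝ) 0) fun s => max (-(c s : ℝ)) 0),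
        elim_mem_dualFeasible_iff.2 ⟨le_rfl, fun s => le_max_right _ _, fun s => le_max_right _ _,
          fun s => ?_⟩⟩
      rcases le_total (c s : ℝ) 0 with hs | hs <;> simp [hs]
    obtain ⟨Y, hY, hmax⟩ := h hne ⟨B, by
      rintro _ ⟨Y, hY, rfl⟩
      obtain ⟨y, α, β, rfl⟩ := sum_elim_surj Y
      dsimp only
      rw [elim_dotProduct_eq_boxValue]
      exact hB _ _ _ (elim_mem_dualFeasible_iff.1 hY)⟩
    obtain ⟨y, α, β, rfl⟩ := sum_elim_surj Y
    rw [realVec_elim] at hY hmax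
    refine ⟨y, α, β, elim_mem_dualFeasible_iff.1 hY, fun y' α' β' h' => ?_⟩
    have := hmax _ (elim_mem_dualFeasible_iff.2 h')
    rwa [elim_dotProduct_eq_boxValue, elim_dotProduct_eq_boxValue] at this
  · rintro h - ⟨B, hB⟩
    obtain ⟨y, α, β, hy, hmax⟩ := h B fun y α β hy => by
      have := hB ⟨_, elim_mem_dualFeasible_iff.2 hy, rfl⟩
      dsimp only at this
      rwa [elim_dotProduct_eq_boxValue] at this
    refine ⟨Sum.elim y (Sum.elim α β), ?_, fun Y hY => ?_⟩
    · rw [realVec_elim]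
      exact elim_mem_dualFeasible_iff.2 hy
    · obtain ⟨y', α', β', rfl⟩ := sum_elim_surj Y
      rw [realVec_elim, elim_dotProduct_eq_boxValue, elim_dotProduct_eq_boxValue]
      exact hmax _ _ _ (elim_mem_dualFeasible_iff.1 hY)

theorem sum_mul_eq_sum_subtype {P : m → Prop} [Fintype {i // P i}] {y : m → ℝ}
    (hy : ∀ i, ¬P i → y i = 0) (X : m → ℝ) :
    ∑ i, y i * X i = ∑ j : {i // P i}, y j * X j := by
  classical
  rw [← Fintype.sum_subtype_add_sum_subtype P fun i => y i * X i]
  have : ∑ j : {i // ¬P i}, y j * X j = 0 :=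
    Finset.sum_eq_zero fun j _ => by rw [hy j j.2, zero_mul]
  rw [this, add_zero]
  convert rfl

end BoxDual

/-! ### Box-total dual integrality of the tight rows -/

section TightRows

variable {m S : Type*} [Fintype m] [Fintype S] {Q : Matrix m S ℤ} {p : m → ℤ} {z₀ : S → ℤ}

theorem isBoxDual_tightRows_iff {c : S → ℤ} {y : m → ℝ} {α β : S → ℝ}
    (hy : ∀ i, (Q *ᵥ z₀) i ≠ p i → y i = 0) :
    IsBoxDual (tightRows Q p z₀) c (fun j => y j) α β ↔ IsBoxDual Q c y α β := by
  have h₀ : (0 : {i // (Q *ᵥ z₀) i = p i} → ℝ) ≤ (fun j => y j.1) ↔ 0 ≤ y := by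
    refine ⟨fun h i => ?_, fun h j => h j⟩
    by_cases hi : (Q *ᵥ z₀) i = p i
    · exact h ⟨i, hi⟩
    · exact (hy i hi).ge
  simp only [IsBoxDual, h₀, sum_mul_eq_sum_subtype hy]
  rfl

theorem boxValue_zero {f g : S → ℚ} {y : m → ℝ} {α β : S → ℝ} :
    boxValue 0 f g y α β = ∑ s, (α s * (f s : ℝ) - β s * (g s : ℝ)) := by
  simp [boxValue]

/-- The dual objective function for a box that is translated to `z₀` and scaled by `ε`. -/
theorem boxValue_translate {c : S → ℤ} {y : m → ℝ} {α β : S → ℝ} (h : IsBoxDual Q c y α β)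
    (f g : S → ℚ) (ε : ℚ) :
    boxValue (fun i => (p i : ℚ)) (fun s => z₀ s + ε * f s) (fun s => z₀ s + ε * g s) y α β =
      ∑ s, (c s : ℝ) * z₀ s - ∑ i, y i * (((Q *ᵥ z₀) i : ℤ) - p i : ℝ) +
        ε * ∑ s, (α s * (f s : ℝ) - β s * (g s : ℝ)) := by
  have h₁ : ∑ s, (c s : ℝ) * z₀ s =
      ∑ i, y i * (((Q *ᵥ z₀) i : ℤ) : ℝ) + ∑ s, (α s * z₀ s - β s * z₀ s) := by
    simp only [← h.2.2.2, cast_mulVec_apply, realVec, sub_mul, add_mul, Finset.sum_mul,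
      Finset.mul_sum, Finset.sum_add_distrib, Finset.sum_sub_distrib]
    rw [Finset.sum_comm]
    simp only [mul_assoc]
    ring
  rw [h₁]
  simp only [boxValue, mul_sub, Finset.sum_sub_distrib, Finset.mul_sum, Rat.cast_intCast,
    Rat.cast_add, Rat.cast_mul, mul_add, Finset.sum_add_distrib]
  have h₂ : ∀ (γ : S → ℝ) (l : S → ℚ), ∑ s, γ s * ((ε : ℝ) * l s) = ∑ s, (ε : ℝ) * (γ s * l s) :=
    fun γ l => Finset.sum_congr rfl fun s _ => by ring
  rw [h₂, h₂]
  ring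

/-- The constraints that are tight at an integral point of a box-TDI system form a box-TDI
system. -/
theorem isBoxTDI_tightRows [DecidableEq S]
    (hbox : IsBoxTDI (Q.map (Int.cast : ℤ → ℚ)) fun i => (p i : ℚ))
    (hz₀ : realVec z₀ ∈ polyhedron Q p) :
    IsBoxTDI ((tightRows Q p z₀).map (Int.cast : ℤ → ℚ)) 0 := by
  classical
  rw [isBoxTDI_iff] at hbox ⊢
  intro f g hfg c B hB
  simp only [boxValue_zero] at hB ⊢
  -- `N i` bounds what a unit of weight on row `i` can lose, before scaling by `ε`, when it is moved
  -- onto the box rows. Slacks at z₀ are integers, so a row that is not tight has slack at least 1,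
  -- and `ε * N i < 1` makes the move strictly profitable.
  set N : m → ℚ := fun i => ∑ s, |(Q i s : ℚ)| * (|f s| + |g s|) with hN
  have hN₀ : ∀ i, 0 ≤ N i := fun i => Finset.sum_nonneg fun s _ => by positivity
  obtain ⟨ε, hε, hεN⟩ : ∃ ε : ℚ, 0 < ε ∧ ∀ i, ε * N i < 1 := by
    have hs : 0 ≤ ∑ i, N i := Finset.sum_nonneg fun i _ => hN₀ i
    refine ⟨(∑ i, N i + 1)⁻¹, by positivity, fun i => ?_⟩
    rw [inv_mul_lt_iff₀ (by positivity), mul_one]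
    have := Finset.single_le_sum (fun j _ => hN₀ j) (Finset.mem_univ i)
    linarith
  have hslack : ∀ i, (Q *ᵥ z₀) i ≠ p i → (1 : ℝ) ≤ ((Q *ᵥ z₀) i : ℤ) - p i := by
    intro i hi
    have h₁ := mem_polyhedron_iff.1 hz₀ i
    rw [← cast_mulVec_apply] at h₁
    have h₂ : p i + 1 ≤ (Q *ᵥ z₀) i := lt_of_le_of_ne (by exact_mod_cast h₁) (Ne.symm hi)
    have h₃ : ((p i + 1 : ℤ) : ℝ) ≤ ((Q *ᵥ z₀) i : ℤ) := Int.cast_le.2 h₂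
    push_cast at h₃
    linarith
  -- moving the weight of the constraints that are not tight to the box constraints
  have hmove : ∀ y α β, IsBoxDual Q c y α β → ∃ y' α' β', IsBoxDual Q c y' α' β' ∧
      (∀ i, (Q *ᵥ z₀) i ≠ p i → y' i = 0) ∧
      (ε : ℝ) * ∑ s, (α s * (f s : ℝ) - β s * (g s : ℝ)) -
          ∑ i, (if (Q *ᵥ z₀) i = p i then 0 else y i * ((ε : ℝ) * N i)) ≤
        (ε : ℝ) * ∑ s, (α' s * (f s : ℝ) - β' s * (g s : ℝ)) := by
    rintro y α β ⟨hy, hα, hβ, hc⟩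
    set u : m → ℝ := fun i => if (Q *ᵥ z₀) i = p i then 0 else y i with hu
    have hu₀ : ∀ i, 0 ≤ u i := fun i => by
      simp only [hu]
      split_ifs
      exacts [le_rfl, hy i]
    -- Each row that is not tight is split into positive and negative parts, absorbed by the lower
    -- and upper bounds respectively.
    refine ⟨y - u, α + fun s => ∑ i, u i * max (Q i s : ℝ) 0,
      β + fun s => ∑ i, u i * max (-(Q i s : ℝ)) 0, ⟨fun i => ?_, ?_, ?_, fun s => ?_⟩,
      fun i hi => ?_, ?_⟩
    · simp only [hu, Pi.sub_apply, Pi.zero_apply]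
      split_ifs
      · simpa using hy i
      · simp
    · exact add_nonneg hα fun s =>
        Finset.sum_nonneg fun i _ => mul_nonneg (hu₀ i) (le_max_right _ _)
    · exact add_nonneg hβ fun s =>
        Finset.sum_nonneg fun i _ => mul_nonneg (hu₀ i) (le_max_right _ _)
    · have h₁ : ∑ i, u i * (Q i s : ℝ) =
          ∑ i, u i * max (Q i s : ℝ) 0 - ∑ i, u i * max (-(Q i s : ℝ)) 0 := by
        rw [← Finset.sum_sub_distrib]
        refine Finset.sum_congr rfl fun i _ => ?_
        rw [← mul_sub]
        rcases le_total (Q i s : ℝ) 0 with h | h <;> simp [h]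
      rw [← hc s]
      simp only [Pi.sub_apply, Pi.add_apply, sub_mul, Finset.sum_sub_distrib, h₁]
      ring
    · simp [hu, hi]
    · have h₁ : ∀ i, ∑ s, (u i * max (Q i s : ℝ) 0 * f s - u i * max (-(Q i s : ℝ)) 0 * g s) ≥
          -(u i * N i) := by
        intro i
        simp only [hN, Rat.cast_sum, Finset.mul_sum, ← Finset.sum_neg_distrib]
        refine Finset.sum_le_sum fun s _ => ?_
        have h₂ : -(|(Q i s : ℝ)| * (|(f s : ℝ)| + |(g s : ℝ)|)) ≤
            max (Q i s : ℝ) 0 * f s - max (-(Q i s : ℝ)) 0 * g s := by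
          rcases le_total (Q i s : ℝ) 0 with h | h
          · simp only [max_eq_right h, max_eq_left (neg_nonneg.2 h), abs_of_nonpos h]
            nlinarith [le_abs_self (g s : ℝ), abs_nonneg (f s : ℝ)]
          · simp only [max_eq_left h, max_eq_right (neg_nonpos.2 h), abs_of_nonneg h]
            nlinarith [neg_abs_le (f s : ℝ), abs_nonneg (g s : ℝ)]
        have := mul_le_mul_of_nonneg_left h₂ (hu₀ i)
        push_cast
        linarith
      have h₂ : ∑ s, ((α + fun s => ∑ i, u i * max (Q i s : ℝ) 0) s * (f s : ℝ) -
          (β + fun s => ∑ i, u i * max (-(Q i s : ℝ)) 0) s * (g s : ℝ)) =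
          ∑ s, (α s * (f s : ℝ) - β s * (g s : ℝ)) +
          ∑ i, ∑ s, (u i * max (Q i s : ℝ) 0 * f s - u i * max (-(Q i s : ℝ)) 0 * g s) := by
        rw [Finset.sum_comm, ← Finset.sum_add_distrib]
        refine Finset.sum_congr rfl fun s _ => ?_
        simp only [Pi.add_apply, Finset.sum_sub_distrib, add_mul, Finset.sum_mul]
        ring
      have h₃ : ∑ i, (if (Q *ᵥ z₀) i = p i then 0 else y i * ((ε : ℝ) * N i)) =
          ε * ∑ i, u i * (N i : ℝ) := by
        rw [Finset.mul_sum]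
        refine Finset.sum_congr rfl fun i _ => ?_
        simp only [hu]
        split_ifs <;> ring
      rw [h₂, h₃, mul_add]
      have h₄ : -∑ i, u i * (N i : ℝ) ≤
          ∑ i, ∑ s, (u i * max (Q i s : ℝ) 0 * f s - u i * max (-(Q i s : ℝ)) 0 * g s) := by
        rw [← Finset.sum_neg_distrib]
        exact Finset.sum_le_sum fun i _ => h₁ i
      have hε' : (0 : ℝ) ≤ ε := by exact_mod_cast hε.le
      linarith [mul_le_mul_of_nonneg_left h₄ hε']
  have hloss : ∀ y : m → ℝ, 0 ≤ y → ∀ i,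
      (if (Q *ᵥ z₀) i = p i then 0 else y i * ((ε : ℝ) * N i)) ≤
        y i * (((Q *ᵥ z₀) i : ℤ) - p i : ℝ) := by
    intro y hy i
    split_ifs with hi
    · simp [hi]
    · have : (ε : ℝ) * N i < 1 := by exact_mod_cast hεN i
      exact mul_le_mul_of_nonneg_left (this.le.trans (hslack i hi)) (hy i)
  have htight : ∀ y : m → ℝ, (∀ i, (Q *ᵥ z₀) i ≠ p i → y i = 0) →
      ∑ i, y i * (((Q *ᵥ z₀) i : ℤ) - p i : ℝ) = 0 := by
    intro y hy
    refine Finset.sum_eq_zero fun i _ => ?_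
    by_cases hi : (Q *ᵥ z₀) i = p i
    · simp [hi]
    · rw [hy i hi, zero_mul]
  have hε' : (0 : ℝ) < ε := by exact_mod_cast hε
  obtain ⟨y, α, β, hd, hmax⟩ := hbox (fun s => z₀ s + ε * f s) (fun s => z₀ s + ε * g s)
    (fun s => by
      have := mul_le_mul_of_nonneg_left (hfg s) hε.le
      dsimp only
      linarith) c (∑ s, (c s : ℝ) * z₀ s + ε * B) (by
    intro y α β h
    obtain ⟨y', α', β', h', hy', hle⟩ := hmove y α β h
    rw [boxValue_translate h]
    have h₁ := hB _ α' β' ((isBoxDual_tightRows_iff hy').2 h')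
    have h₂ := Finset.sum_le_sum fun i (_ : i ∈ Finset.univ) => hloss y h.1 i
    have h₃ := mul_le_mul_of_nonneg_left h₁ hε'.le
    linarith)
  -- Otherwise moving the weight to the box rows would strictly improve the optimal dual solution.
  -- The integral optimum thus lives on the tight rows.
  have hzero : ∀ i, (Q *ᵥ z₀) i ≠ p i → realVec y i = 0 := by
    intro i hi
    by_contra hyi
    have hpos : 0 < realVec y i := lt_of_le_of_ne (hd.1 i) (Ne.symm hyi)
    obtain ⟨y', α', β', h', hy', hle⟩ := hmove _ _ _ hd
    have h₁ := hmax _ _ _ h'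
    rw [boxValue_translate h', boxValue_translate hd, htight y' hy'] at h₁
    have h₂ := Finset.sum_lt_sum (fun i (_ : i ∈ Finset.univ) => hloss _ hd.1 i)
      ⟨i, Finset.mem_univ i, by
        rw [if_neg hi]
        have : (ε : ℝ) * N i < 1 := by exact_mod_cast hεN i
        exact mul_lt_mul_of_pos_left (this.trans_le (hslack i hi)) hpos⟩
    linarith
  refine ⟨fun j => y j, α, β, (isBoxDual_tightRows_iff hzero).2 hd, fun y' α' β' h' => ?_⟩
  set u : m → ℝ := fun i => if hi : (Q *ᵥ z₀) i = p i then y' ⟨i, hi⟩ else 0 with hu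
  have hu₀ : ∀ i, (Q *ᵥ z₀) i ≠ p i → u i = 0 := fun i hi => dif_neg hi
  have huy : (fun j : {i // (Q *ᵥ z₀) i = p i} => u j) = y' := funext fun j => dif_pos j.2
  rw [← huy, isBoxDual_tightRows_iff hu₀] at h'
  have h₁ := hmax _ _ _ h'
  rw [boxValue_translate h', boxValue_translate hd, htight _ hu₀, htight _ hzero] at h₁
  exact le_of_mul_le_mul_left (by linarith) hε'

end TightRows

/-! ### Box-integrality of the dual cone -/

section DualConeVertices

variable {m S : Type*} [Fintype m] [Fintype S]

/-- Finitely many strict inequalities that hold at `ε = 0` persist for small `ε`; this serves to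
perturb without leaving a face. -/
theorem exists_pos_forall_mul_abs_lt {ι : Type*} [Finite ι] (u e : ι → ℝ) :
    ∃ ε : ℝ, 0 < ε ∧ ∀ i, 0 < u i → ε * |e i| < u i := by
  have h : ∀ᶠ ε : ℝ in nhdsWithin 0 (Set.Ioi 0), ∀ i, 0 < u i → ε * |e i| < u i := by
    refine Filter.eventually_all.2 fun i => ?_
    by_cases hi : 0 < u i
    · have hc : ContinuousAt (fun ε : ℝ => ε * |e i|) 0 := by fun_prop
      have := hc.eventually (gt_mem_nhds (show 0 * |e i| < u i by simpa using hi))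
      exact (this.filter_mono nhdsWithin_le_nhds).mono fun ε hε _ => hε
    · exact Filter.Eventually.of_forall fun ε h => absurd h hi
  obtain ⟨ε, hε, hpos⟩ := (h.and self_mem_nhdsWithin).exists
  exact ⟨ε, hpos, hε⟩

/-- Strict complementarity: an element of the dual cone has a representation whose support is cut
out by a rational element of the cone. -/
theorem exists_strictly_complementary {K : Matrix m S ℤ} {v : S → ℝ} (hv : v ∈ dualCone K) :
    ∃ (y : m → ℝ) (z : S → ℚ), 0 ≤ y ∧ (∀ s, v s = ∑ i, y i * (K i s : ℝ)) ∧
      (∀ i, 0 ≤ ∑ s, (K i s : ℚ) * z s) ∧ ∀ i, y i = 0 ↔ 0 < ∑ s, (K i s : ℚ) * z s := by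
  classical
  -- The supports of the representations of `v`; one of maximal cardinality is chosen.
  let F : Finset (Finset m) := Finset.univ.filter fun I =>
    ∃ y : m → ℝ, 0 ≤ y ∧ (∀ s, v s = ∑ i, y i * (K i s : ℝ)) ∧ ∀ i, i ∈ I ↔ y i ≠ 0
  have hF : F.Nonempty := by
    obtain ⟨y, hy, hvy⟩ := hv
    exact ⟨Finset.univ.filter fun i => y i ≠ 0, Finset.mem_filter.2 ⟨Finset.mem_univ _, y, hy,
      fun s => congrFun hvy s, fun i => by simp⟩⟩
  obtain ⟨I, hI, hmax⟩ := F.exists_max_image Finset.card hF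
  obtain ⟨y, hy, hvy, hIy⟩ := (Finset.mem_filter.1 hI).2
  have hpos : ∀ j, j ∈ I → 0 < y j := fun j hj => lt_of_le_of_ne (hy j) (Ne.symm ((hIy j).1 hj))
  -- If no such `z` existed, Farkas' lemma over ℚ would give a linear relation `e` among the rows,
  -- positive at `i` and nonnegative off `I`; adding a small multiple of it to `y` would enlarge the
  -- support. Rationality of `z` matters because it becomes the centre of a box.
  have key : ∀ i, i ∉ I → ∃ z : S → ℚ, (∀ j, 0 ≤ ∑ s, (K j s : ℚ) * z s) ∧
      (∀ j ∈ I, ∑ s, (K j s : ℚ) * z s = 0) ∧ 0 < ∑ s, (K i s : ℚ) * z s := by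
    intro i hi
    let N : Matrix (m ⊕ m) S ℚ := Matrix.fromRows (K.map Int.cast)
      (Matrix.of fun j s => if j ∈ I then -(K j s : ℚ) else 0)
    by_contra hcon
    obtain ⟨μ, hμ, hμN⟩ := farkas_matrix N (fun s => -(K i s : ℚ)) (by
      intro z hz
      by_contra hneg
      have h₁ : ∀ j, 0 ≤ ∑ s, (K j s : ℚ) * z s := fun j => by
        simpa [N, Matrix.mulVec, dotProduct] using hz (Sum.inl j)
      refine hcon ⟨z, h₁, fun j hj => le_antisymm ?_ (h₁ j), ?_⟩
      · simpa [N, Matrix.mulVec, dotProduct, hj] using hz (Sum.inr j)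
      · simpa [dotProduct] using hneg)
    let e : m → ℝ := fun j =>
      (if j = i then 1 else 0) + (μ (Sum.inl j) : ℝ) - if j ∈ I then (μ (Sum.inr j) : ℝ) else 0
    have he : ∀ s, ∑ j, e j * (K j s : ℝ) = 0 := by
      intro s
      have := congrFun hμN s
      simp only [N, Matrix.vecMul, dotProduct, Fintype.sum_sum_type, Matrix.fromRows_apply_inl,
        Matrix.fromRows_apply_inr, Matrix.map_apply, Matrix.of_apply] at this
      have h₂ := congrArg (Rat.cast : ℚ → ℝ) this
      push_cast at h₂
      have h₃ : ∑ j, e j * (K j s : ℝ) = K i s + (∑ j, (μ (Sum.inl j) : ℝ) * (K j s : ℝ) +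
          ∑ j, (μ (Sum.inr j) : ℝ) * ((if j ∈ I then -(K j s : ℚ) else 0 : ℚ) : ℝ)) := by
        have h₄ : (K i s : ℝ) = ∑ j, if j = i then (K j s : ℝ) else 0 := by simp
        rw [h₄, ← Finset.sum_add_distrib, ← Finset.sum_add_distrib]
        refine Finset.sum_congr rfl fun j _ => ?_
        simp only [e]
        split_ifs <;> push_cast <;> ring
      rw [h₃, ← h₂]
      ring
    obtain ⟨ε, hε, hεe⟩ := exists_pos_forall_mul_abs_lt y e
    have hεpos : ∀ j, 0 < y j → 0 < y j + ε * e j := fun j hj => by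
      have := mul_le_mul_of_nonneg_left (neg_abs_le (e j)) hε.le
      linarith [hεe j hj]
    have he₀ : ∀ j, j ∉ I → 0 ≤ e j := by
      intro j hj
      have : (0 : ℝ) ≤ μ (Sum.inl j) := by exact_mod_cast hμ (Sum.inl j)
      simp only [e, hj, if_false]
      split_ifs <;> linarith
    have hei : 0 < e i := by
      have : (0 : ℝ) ≤ μ (Sum.inl i) := by exact_mod_cast hμ (Sum.inl i)
      simp only [e, hi, if_false, if_true]
      linarith
    have hsub : insert i I ⊆ Finset.univ.filter fun j => y j + ε * e j ≠ 0 := by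
      intro j hj
      rw [Finset.mem_filter]
      refine ⟨Finset.mem_univ j, ?_⟩
      rcases Finset.mem_insert.1 hj with rfl | hj
      · exact (add_pos_of_nonneg_of_pos (hy j) (mul_pos hε hei)).ne'
      · exact (hεpos j (hpos j hj)).ne'
    have h₁ := hmax (Finset.univ.filter fun j => y j + ε * e j ≠ 0)
      (Finset.mem_filter.2 ⟨Finset.mem_univ _, fun j => y j + ε * e j, fun j => by
        by_cases hj : j ∈ I
        · exact (hεpos j (hpos j hj)).le
        · exact add_nonneg (hy j) (mul_nonneg hε.le (he₀ j hj)), fun s => by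
        have : ∑ j, (y j + ε * e j) * (K j s : ℝ) =
            ∑ j, y j * (K j s : ℝ) + ε * ∑ j, e j * (K j s : ℝ) := by
          rw [Finset.mul_sum, ← Finset.sum_add_distrib]
          exact Finset.sum_congr rfl fun j _ => by ring
        rw [this, he, mul_zero, add_zero, hvy], fun j => by simp⟩)
    have h₂ := Finset.card_le_card hsub
    rw [Finset.card_insert_of_notMem hi] at h₂
    omega
  choose! z hz₀ hzI hzi using key
  have hswap : ∀ j, ∑ s, (K j s : ℚ) * (∑ i ∈ Finset.univ.filter (· ∉ I), z i) s =
      ∑ i ∈ Finset.univ.filter (· ∉ I), ∑ s, (K j s : ℚ) * z i s := by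
    intro j
    simp only [Finset.sum_apply, Finset.mul_sum]
    exact Finset.sum_comm
  have hnonneg : ∀ j, ∀ i ∈ Finset.univ.filter (· ∉ I), 0 ≤ ∑ s, (K j s : ℚ) * z i s :=
    fun j i hi => hz₀ i (Finset.mem_filter.1 hi).2 j
  refine ⟨y, ∑ i ∈ Finset.univ.filter (· ∉ I), z i, hy, hvy, fun j => ?_, fun j => ?_⟩
  · rw [hswap]
    exact Finset.sum_nonneg (hnonneg j)
  · rw [hswap]
    by_cases hj : j ∈ I
    · rw [Finset.sum_eq_zero fun i hi => hzI i (Finset.mem_filter.1 hi).2 j hj]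
      simp [(hpos j hj).ne']
    · have hj' : j ∈ Finset.univ.filter (· ∉ I) := by simpa using hj
      have h₁ := (hzi j hj).trans_le (Finset.single_le_sum (hnonneg j) hj')
      have h₂ : y j = 0 := by
        by_contra h
        exact hj ((hIy j).2 h)
      exact ⟨fun _ => h₁, fun _ => h₂⟩

/-- The dual of a box-TDI cone is box-integral: the extreme points of its intersection with an
integral box are integral. -/
theorem extremePoint_integral_dualCone [DecidableEq S] {K : Matrix m S ℤ}
    (hK : IsBoxTDI (K.map (Int.cast : ℤ → ℚ)) 0) {a b : S → ℤ} {v : S → ℝ}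
    (hv : v ∈ (dualCone K ∩ Set.Icc (realVec a) (realVec b)).extremePoints ℝ) :
    v ∈ Set.range (realVec : (S → ℤ) → S → ℝ) := by
  classical
  obtain ⟨⟨hvK, hav, hvb⟩, hext⟩ := hv
  obtain ⟨y, z, hy, hvy, hz, hyz⟩ := exists_strictly_complementary hvK
  -- `T` collects the coordinates where `v` meets the box. The auxiliary program has cost `c`, equal
  -- to `v` on `T` and to 0 elsewhere, and a box around `z` with half-width 1 on `T` and 0 off `T`.
  -- Its dual objective is at most `c` times `z`, with equality exactly when `y` vanishes on the
  -- rows positive at `z` and `α`, `β` vanish on `T`.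
  let T : S → Prop := fun s => v s = a s ∨ v s = b s
  let c : S → ℤ := fun s => if v s = a s then a s else if v s = b s then b s else 0
  have hcT : ∀ s, T s → (c s : ℝ) = v s := by
    intro s hs
    simp only [c]
    split_ifs with h₁ h₂
    exacts [h₁.symm, h₂.symm, (hs.elim h₁ h₂).elim]
  let χ : S → ℚ := fun s => if T s then 1 else 0
  have hχ : ∀ s, 0 ≤ χ s := fun s => by
    simp only [χ]
    split_ifs <;> norm_num
  rw [isBoxTDI_iff] at hK
  simp only [boxValue_zero] at hK
  have hval : ∀ (y : m → ℝ) (α β : S → ℝ), IsBoxDual K c y α β →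
      ∑ s, (α s * ((z s - χ s : ℚ) : ℝ) - β s * ((z s + χ s : ℚ) : ℝ)) =
        ∑ s, (c s : ℝ) * z s - ∑ i, y i * ((∑ s, (K i s : ℚ) * z s : ℚ) : ℝ) -
          ∑ s, (χ s : ℝ) * (α s + β s) := by
    rintro y α β ⟨-, -, -, h⟩
    have h₁ : ∑ i, y i * ((∑ s, (K i s : ℚ) * z s : ℚ) : ℝ) =
        ∑ s, (∑ i, y i * (K i s : ℝ)) * z s := by
      push_cast
      simp only [Finset.mul_sum, Finset.sum_mul]
      rw [Finset.sum_comm]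
      simp only [mul_assoc]
    rw [h₁, ← Finset.sum_sub_distrib, ← Finset.sum_sub_distrib]
    refine Finset.sum_congr rfl fun s _ => ?_
    rw [← h s]
    push_cast
    ring
  have hzR : ∀ i, (0 : ℝ) ≤ ((∑ s, (K i s : ℚ) * z s : ℚ) : ℝ) := fun i => by
    exact_mod_cast hz i
  have hχR : ∀ s, (0 : ℝ) ≤ χ s := fun s => by exact_mod_cast hχ s
  have hterm₁ : ∀ y : m → ℝ, 0 ≤ y →
      ∀ i ∈ Finset.univ, 0 ≤ y i * ((∑ s, (K i s : ℚ) * z s : ℚ) : ℝ) :=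
    fun y hy i _ => mul_nonneg (hy i) (hzR i)
  have hterm₂ : ∀ α β : S → ℝ, 0 ≤ α → 0 ≤ β → ∀ s ∈ Finset.univ, 0 ≤ (χ s : ℝ) * (α s + β s) :=
    fun α β hα hβ s _ => mul_nonneg (hχR s) (add_nonneg (hα s) (hβ s))
  obtain ⟨y', α', β', hd, hmax⟩ := hK (fun s => z s - χ s) (fun s => z s + χ s)
    (fun s => by
      have := hχ s
      dsimp only
      linarith) c (∑ s, (c s : ℝ) * z s) (by
    intro y α β h
    rw [hval y α β h]
    have h₁ := Finset.sum_nonneg (hterm₁ y h.1)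
    have h₂ := Finset.sum_nonneg (hterm₂ α β h.2.1 h.2.2.1)
    linarith)
  -- The representation of `v` attains the bound, so an integral optimum attains it too: its support
  -- lies in that of `y`, and its combination of rows agrees with `v` on `T`.
  have hd₀ : IsBoxDual K c y (fun s => max (c s - v s) 0) fun s => max (-(c s - v s)) 0 := by
    refine ⟨hy, fun s => le_max_right _ _, fun s => le_max_right _ _, fun s => ?_⟩
    rw [← hvy]
    dsimp only
    rcases le_total (c s - v s) 0 with h | h
    · rw [max_eq_right h, max_eq_left (neg_nonneg.2 h)]
      ring
    · rw [max_eq_left h, max_eq_right (neg_nonpos.2 h)]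
      ring
  have hopt := hmax _ _ _ hd₀
  rw [hval _ _ _ hd₀, hval _ _ _ hd] at hopt
  have hs₁ : ∑ i, y i * ((∑ s, (K i s : ℚ) * z s : ℚ) : ℝ) = 0 := by
    refine Finset.sum_eq_zero fun i _ => ?_
    by_cases hi : y i = 0
    · rw [hi, zero_mul]
    · have h₁ : ∑ s, (K i s : ℚ) * z s = 0 :=
        le_antisymm (not_lt.1 fun h => hi ((hyz i).2 h)) (hz i)
      rw [h₁, Rat.cast_zero, mul_zero]
  have hs₂ : ∑ s, (χ s : ℝ) * (max (c s - v s) 0 + max (-(c s - v s)) 0) = 0 := by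
    refine Finset.sum_eq_zero fun s _ => ?_
    by_cases hs : T s
    · simp [hcT s hs]
    · simp [χ, hs]
  rw [hs₁, hs₂] at hopt
  have hn₁ := Finset.sum_nonneg (hterm₁ _ hd.1)
  have hn₂ := Finset.sum_nonneg (hterm₂ _ _ hd.2.1 hd.2.2.1)
  have hy' : ∀ i, y i = 0 → realVec y' i = 0 := by
    intro i hi
    have h₁ := (Finset.sum_eq_zero_iff_of_nonneg (hterm₁ _ hd.1)).1 (by linarith) i
      (Finset.mem_univ i)
    have h₂ : (0 : ℝ) < ((∑ s, (K i s : ℚ) * z s : ℚ) : ℝ) := by exact_mod_cast (hyz i).1 hi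
    exact (mul_eq_zero.1 h₁).resolve_right h₂.ne'
  have hT' : ∀ s, T s → ∑ i, realVec y' i * (K i s : ℝ) = v s := by
    intro s hs
    have h₁ := (Finset.sum_eq_zero_iff_of_nonneg (hterm₂ _ _ hd.2.1 hd.2.2.1)).1 (by linarith) s
      (Finset.mem_univ s)
    simp only [χ, hs, if_true, Rat.cast_one, one_mul] at h₁
    have hα := hd.2.1 s
    have hβ := hd.2.2.1 s
    simp only [Pi.zero_apply] at hα hβ
    rw [← hcT s hs, ← hd.2.2.2 s]
    linarith
  let v' : S → ℤ := fun s => ∑ i, y' i * K i s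
  have hv' : ∀ s, realVec v' s = ∑ i, realVec y' i * (K i s : ℝ) := fun s => by
    simp [v', realVec]
  refine ⟨v', ?_⟩
  obtain ⟨ε, hε, hsmall⟩ := exists_pos_forall_mul_abs_lt
    (Sum.elim y (Sum.elim (v - realVec a) (realVec b - v)))
    (Sum.elim (y - realVec y') (Sum.elim (v - realVec v') (v - realVec v')))
  simp only [Sum.forall, Sum.elim_inl, Sum.elim_inr, Pi.sub_apply] at hsmall
  obtain ⟨hs₀, hsa, hsb⟩ := hsmall
  have habs : ∀ r t : ℝ, |r| = ε → |r * t| = ε * |t| := fun r t hr => by rw [abs_mul, hr]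
  -- The integral vector `v'` satisfies with equality whatever is tight at `v`, so `v` can be moved
  -- both ways along `v - v'`; extremality then gives `v = v'`.
  have hmem : ∀ r : ℝ, |r| = ε →
      v + r • (v - realVec v') ∈ dualCone K ∩ Set.Icc (realVec a) (realVec b) := by
    intro r hr
    refine ⟨⟨fun i => y i + r * (y i - realVec y' i), fun i => ?_, funext fun s => ?_⟩, ?_⟩
    · by_cases hi : y i = 0
      · simp [hi, hy' i hi]
      · have h₁ := hs₀ i (lt_of_le_of_ne (hy i) (Ne.symm hi))
        rw [← habs r _ hr] at h₁
        have h₂ := neg_abs_le (r * (y i - realVec y' i))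
        simp only [Pi.zero_apply]
        linarith
    · simp only [Pi.add_apply, Pi.smul_apply, Pi.sub_apply, smul_eq_mul, hv', Matrix.vecMul,
        dotProduct, Matrix.map_apply]
      rw [hvy, ← Finset.sum_sub_distrib, Finset.mul_sum, ← Finset.sum_add_distrib]
      exact Finset.sum_congr rfl fun i _ => by ring
    · rw [Set.mem_Icc, Pi.le_def, Pi.le_def, ← forall_and]
      intro s
      simp only [Pi.add_apply, Pi.smul_apply, Pi.sub_apply, smul_eq_mul]
      by_cases hs : T s
      · rw [hv', hT' s hs, sub_self, mul_zero, add_zero]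
        exact ⟨hav s, hvb s⟩
      · have h₁ := hsa s (sub_pos.2 (lt_of_le_of_ne (hav s) fun h => hs (Or.inl h.symm)))
        have h₂ := hsb s (sub_pos.2 (lt_of_le_of_ne (hvb s) fun h => hs (Or.inr h)))
        rw [← habs r _ hr] at h₁ h₂
        have h₃ := neg_abs_le (r * (v s - realVec v' s))
        have h₄ := le_abs_self (r * (v s - realVec v' s))
        constructor <;> linarith
  have heq := hext (hmem ε (abs_of_pos hε)) (hmem (-ε) (by rw [abs_neg, abs_of_pos hε]))
    ⟨1 / 2, 1 / 2, by norm_num, by norm_num, by norm_num, by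
      ext s
      simp only [Pi.add_apply, Pi.smul_apply, Pi.sub_apply, smul_eq_mul]
      ring⟩
  have h₀ : ε • (v - realVec v') = 0 := by simpa using heq
  exact (sub_eq_zero.1 ((smul_eq_zero.1 h₀).resolve_left hε.ne')).symm

end DualConeVertices

/-! ### Discrete subgradients and conjugates -/

section DiscreteConvex

variable {φ : ℤ → WithTop ℤ}

theorem coe_untopD {φ : ℤ → WithTop ℤ} {k : ℤ} (h : φ k ≠ ⊤) :
    φ k = (((φ k).untopD 0 : ℤ) : WithTop ℤ) := by
  obtain ⟨a, ha⟩ := WithTop.ne_top_iff_exists.1 h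
  rw [← ha]
  rfl

/-- A fitting pair is a discrete subgradient. -/
theorem IsFitting.add_mul_le (hφ : IsDiscreteConvex φ) {k l : ℤ} (h : IsFitting φ k l) (j : ℤ) :
    φ k + ((l * (j - k) : ℤ) : WithTop ℤ) ≤ φ j := by
  by_cases hj : φ j = ⊤
  · rw [hj]
    exact le_top
  obtain ⟨hk, h₁, h₂⟩ := h
  -- The default 0 is never used: the effective domain is an interval, so `φ` is finite between `k`
  -- and `j`. There convexity makes the increments monotone, and they are summed from `k` to `j`.
  set a : ℤ → ℤ := fun i => (φ i).untopD 0 with ha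
  have hfin : ∀ i, i ∈ Set.uIcc k j → φ i = (a i : WithTop ℤ) := fun i hi =>
    coe_untopD (hφ.1.uIcc_subset hk hj hi)
  have hconv : ∀ i, i - 1 ∈ Set.uIcc k j → i ∈ Set.uIcc k j → i + 1 ∈ Set.uIcc k j →
      a i + a i ≤ a (i - 1) + a (i + 1) := by
    intro i hi₁ hi₂ hi₃
    have := hφ.2 i (by rw [hfin i hi₂]; exact WithTop.coe_ne_top)
    rw [hfin _ hi₁, hfin _ hi₂, hfin _ hi₃] at this
    exact_mod_cast this
  rw [hfin k Set.left_mem_uIcc, hfin j Set.right_mem_uIcc]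
  rcases le_total k j with hkj | hkj
  · simp only [Set.uIcc_of_le hkj, Set.mem_Icc] at hfin hconv
    have hstep : ∀ n : ℕ, k + n + 1 ≤ j → l + a (k + n) ≤ a (k + n + 1) := by
      intro n
      induction n with
      | zero =>
        intro hn
        rw [Nat.cast_zero, add_zero] at hn ⊢
        rw [hfin k (by omega), hfin (k + 1) (by omega)] at h₂
        exact_mod_cast h₂
      | succ n ih =>
        intro hn
        have h₃ := hconv (k + n + 1) (by omega) (by omega) (by push_cast at hn; omega)
        have h₄ := ih (by push_cast at hn; omega)
        rw [show k + (n : ℤ) + 1 - 1 = k + n by ring] at h₃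
        rw [show k + ((n + 1 : ℕ) : ℤ) = k + n + 1 by push_cast; ring]
        linarith
    have hsum : ∀ n : ℕ, k + n ≤ j → a k + l * n ≤ a (k + n) := by
      intro n
      induction n with
      | zero => simp
      | succ n ih =>
        intro hn
        push_cast at hn ⊢
        have h₃ := ih (by omega)
        have h₄ := hstep n (by omega)
        rw [← add_assoc]
        linarith
    obtain ⟨n, hn⟩ := Int.le.dest hkj
    have := hsum n hn.le
    rw [hn] at this
    rw [show j - k = n by omega]
    exact_mod_cast this
  · simp only [Set.uIcc_of_ge hkj, Set.mem_Icc] at hfin hconv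
    have hstep : ∀ n : ℕ, j ≤ k - n - 1 → a (k - n) ≤ l + a (k - n - 1) := by
      intro n
      induction n with
      | zero =>
        intro hn
        rw [Nat.cast_zero, sub_zero] at hn ⊢
        rw [hfin k (by omega), hfin (k - 1) (by omega)] at h₁
        exact_mod_cast h₁
      | succ n ih =>
        intro hn
        have h₃ := hconv (k - n - 1) (by push_cast at hn; omega) (by omega) (by omega)
        have h₄ := ih (by push_cast at hn; omega)
        rw [show k - (n : ℤ) - 1 + 1 = k - n by ring] at h₃
        rw [show k - ((n + 1 : ℕ) : ℤ) = k - n - 1 by push_cast; ring]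
        linarith
    have hsum : ∀ n : ℕ, j ≤ k - n → a k - l * n ≤ a (k - n) := by
      intro n
      induction n with
      | zero => simp
      | succ n ih =>
        intro hn
        push_cast at hn ⊢
        have h₃ := ih (by omega)
        have h₄ := hstep n (by omega)
        rw [← sub_sub]
        linarith
    obtain ⟨n, hn⟩ := Int.le.dest hkj
    have := hsum n (by omega)
    rw [show k - (n : ℤ) = j by omega] at this
    rw [show j - k = -n by omega, show a k - l * (n : ℤ) = a k + l * -n by ring] at *
    exact_mod_cast this

theorem toEReal_coe (n : ℤ) : toEReal (n : WithTop ℤ) = ((n : ℝ) : EReal) := rfl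

theorem toEReal_top : toEReal ⊤ = ⊤ := rfl

theorem le_conj {k a : ℤ} (h : φ k = (a : WithTop ℤ)) (l : ℤ) :
    (((k * l - a : ℤ) : ℝ) : EReal) ≤ conj φ l := by
  refine le_trans (le_of_eq ?_) (le_iSup _ k)
  rw [h, toEReal_coe, ← EReal.coe_sub]
  push_cast
  rfl

/-- The subgradient inequality says that `k` attains the supremum: this is the equality case of
Fenchel's inequality. -/
theorem conj_eq_of_isFitting (hφ : IsDiscreteConvex φ) {k l a : ℤ} (h : φ k = (a : WithTop ℤ))
    (hfit : IsFitting φ k l) : conj φ l = (((k * l - a : ℤ) : ℝ) : EReal) := by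
  refine le_antisymm (iSup_le fun j => ?_) (le_conj h l)
  by_cases hj : φ j = ⊤
  · rw [hj, toEReal_top, EReal.sub_top]
    exact bot_le
  · have h₁ := hfit.add_mul_le hφ j
    rw [coe_untopD hj, h] at h₁
    rw [coe_untopD hj, toEReal_coe, ← EReal.coe_sub, EReal.coe_le_coe_iff, ← Int.cast_sub,
      Int.cast_le]
    have h₂ : a + l * (j - k) ≤ (φ j).untopD 0 := by exact_mod_cast h₁
    linarith

end DiscreteConvex

/-! ### Separable functions: subgradients and Fenchel's inequality -/

section Separable

variable {S : Type*} [Fintype S] {φ : S → ℤ → WithTop ℤ}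

theorem sepFun_eq_coe {w a : S → ℤ} (h : ∀ s, φ s (w s) = (a s : WithTop ℤ)) :
    sepFun φ w = ((∑ s, a s : ℤ) : WithTop ℤ) := by
  simp [sepFun, h]

theorem ne_top_of_sepFun_ne_top {w : S → ℤ} (h : sepFun φ w ≠ ⊤) (s : S) : φ s (w s) ≠ ⊤ :=
  fun hs => h (WithTop.sum_eq_top.2 ⟨s, Finset.mem_univ s, hs⟩)

theorem exists_eq_coe_of_sepFun_ne_top {w : S → ℤ} (h : sepFun φ w ≠ ⊤) :
    ∃ a : S → ℤ, ∀ s, φ s (w s) = (a s : WithTop ℤ) :=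
  ⟨fun s => (φ s (w s)).untopD 0, fun s => coe_untopD (ne_top_of_sepFun_ne_top h s)⟩

theorem IsSepFitting.exists_eq_coe {w z : S → ℤ} (h : IsSepFitting φ w z) :
    ∃ a : S → ℤ, ∀ s, φ s (w s) = (a s : WithTop ℤ) :=
  ⟨fun s => (φ s (w s)).untopD 0, fun s => coe_untopD (h s).1⟩

theorem IsSepFitting.add_dotProduct_le (hφ : ∀ s, IsDiscreteConvex (φ s)) {w z : S → ℤ}
    (h : IsSepFitting φ w z) (w' : S → ℤ) :
    sepFun φ w + ((z ⬝ᵥ w' - z ⬝ᵥ w : ℤ) : WithTop ℤ) ≤ sepFun φ w' := by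
  have : ((z ⬝ᵥ w' - z ⬝ᵥ w : ℤ) : WithTop ℤ) =
      ∑ s, ((z s * (w' s - w s) : ℤ) : WithTop ℤ) := by
    rw [← WithTop.coe_sum]
    simp [dotProduct, mul_sub]
  rw [this, sepFun, ← Finset.sum_add_distrib]
  exact Finset.sum_le_sum fun s _ => (h s).add_mul_le (hφ s) (w' s)

theorem coe_int_sum (n : S → ℤ) :
    (((∑ s, n s : ℤ) : ℝ) : EReal) = ∑ s, (((n s : ℤ) : ℝ) : EReal) := by
  classical
  induction (Finset.univ : Finset S) using Finset.induction_on with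
  | empty => simp
  | insert s t hs ih => rw [Finset.sum_insert hs, Finset.sum_insert hs, ← ih]; push_cast; rfl

theorem neg_sepConj_le {w a : S → ℤ} (h : ∀ s, φ s (w s) = (a s : WithTop ℤ)) (z : S → ℤ) :
    -sepConj φ z ≤ ((((∑ s, a s) - z ⬝ᵥ w : ℤ) : ℝ) : EReal) := by
  rw [EReal.neg_le, ← EReal.coe_neg, ← Int.cast_neg,
    show -((∑ s, a s) - z ⬝ᵥ w) = ∑ s, (w s * z s - a s) by
      simp [dotProduct, Finset.sum_sub_distrib, mul_comm], coe_int_sum]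
  exact Finset.sum_le_sum fun s _ => le_conj (h s) (z s)

theorem neg_sepConj_eq_of_isSepFitting (hφ : ∀ s, IsDiscreteConvex (φ s)) {w z a : S → ℤ}
    (h : ∀ s, φ s (w s) = (a s : WithTop ℤ)) (hfit : IsSepFitting φ w z) :
    -sepConj φ z = ((((∑ s, a s) - z ⬝ᵥ w : ℤ) : ℝ) : EReal) := by
  rw [neg_eq_iff_eq_neg, ← EReal.coe_neg, ← Int.cast_neg,
    show -((∑ s, a s) - z ⬝ᵥ w) = ∑ s, (w s * z s - a s) by
      simp [dotProduct, Finset.sum_sub_distrib, mul_comm], coe_int_sum]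
  exact Finset.sum_congr rfl fun s _ => conj_eq_of_isFitting (hφ s) (h s) (hfit s)

end Separable

/-! ### The optimality criterion over the dual cone -/

section Optimality

variable {m S : Type*} [Fintype m] [Fintype S]

/-- A theorem of the alternative: either the face of the cone that is orthogonal to `w` has an
element within the bounds `l` on `L` and `u` on `U`, or the dual cone contains a small
perturbation of `w` along which the bounds certify a decrease. -/
theorem exists_mem_cone_or_exists_perturbation {K : Matrix m S ℤ} {w : S → ℝ}
    (hw : w ∈ dualCone K) (L U : S → Prop) (l u : S → ℝ) :
    (∃ z ∈ cone K, w ⬝ᵥ z = 0 ∧ (∀ s, L s → l s ≤ z s) ∧ ∀ s, U s → z s ≤ u s) ∨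
      ∃ α β : S → ℝ, (∀ s, 0 ≤ α s ∧ α s ≤ 1) ∧ (∀ s, 0 ≤ β s ∧ β s ≤ 1) ∧
        (∀ s, α s ≠ 0 → L s) ∧ (∀ s, β s ≠ 0 → U s) ∧ w - α + β ∈ dualCone K ∧
        0 < ∑ s, (α s * l s - β s * u s) := by
  classical
  -- The system for `z` is homogenized by an extra variable `t`, the `Unit` column. A solution with
  -- `t > 0` scales to the required `z`; if there is none, Farkas' lemma applied to `-t` yields the
  -- multipliers.
  let N : Matrix (m ⊕ Unit ⊕ Unit ⊕ S ⊕ S) (S ⊕ Unit) ℝ :=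
    Matrix.fromRows (Matrix.of fun i => Sum.elim (fun s => (K i s : ℝ)) fun _ => 0) <|
    Matrix.fromRows (Matrix.of fun _ => Sum.elim (-w) fun _ => 0) <|
    Matrix.fromRows (Matrix.of fun _ => Sum.elim 0 fun _ => 1) <|
    Matrix.fromRows
      (Matrix.of fun r => if L r then Sum.elim (Pi.single r 1) (fun _ => -l r) else 0)
      (Matrix.of fun r => if U r then Sum.elim (-Pi.single r 1) (fun _ => u r) else 0)
  by_cases h : ∀ x, 0 ≤ N *ᵥ x → 0 ≤ (Sum.elim 0 fun _ => -1 : S ⊕ Unit → ℝ) ⬝ᵥ x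
  · right
    obtain ⟨Y, hY, hYN⟩ := farkas_matrix N _ h
    set y : m → ℝ := fun i => Y (Sum.inl i) with hy
    set θ : ℝ := Y (Sum.inr (Sum.inl ())) with hθ
    set τ : ℝ := Y (Sum.inr (Sum.inr (Sum.inl ()))) with hτ
    let α : S → ℝ := fun s => if L s then Y (Sum.inr (Sum.inr (Sum.inr (Sum.inl s)))) else 0
    let β : S → ℝ := fun s => if U s then Y (Sum.inr (Sum.inr (Sum.inr (Sum.inr s)))) else 0
    have hα : 0 ≤ α := fun s => by
      dsimp only [α]
      split_ifs
      exacts [hY _, le_rfl]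
    have hβ : 0 ≤ β := fun s => by
      dsimp only [β]
      split_ifs
      exacts [hY _, le_rfl]
    have hcol : ∀ s, 0 = ∑ i, y i * (K i s : ℝ) - θ * w s + α s - β s := by
      intro s
      have := congrFun hYN (Sum.inl s)
      simp only [N, Matrix.vecMul, dotProduct, Fintype.sum_sum_type, Matrix.fromRows_apply_inl,
        Matrix.fromRows_apply_inr, Matrix.of_apply, Sum.elim_inl, Pi.zero_apply,
        Finset.univ_unique, Finset.sum_singleton, Pi.neg_apply, mul_zero] at this
      have h₁ : ∑ r, Y (Sum.inr (Sum.inr (Sum.inr (Sum.inl r)))) *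
          (if L r then Sum.elim (Pi.single r 1) (fun _ => -l r) else 0 : S ⊕ Unit → ℝ)
            (Sum.inl s) = α s := by
        rw [Finset.sum_eq_single s]
        · by_cases hs : L s <;> simp [α, hs]
        · intro r _ hr
          by_cases hs : L r <;> simp [hs, Ne.symm hr]
        · simp
      have h₂ : ∑ r, Y (Sum.inr (Sum.inr (Sum.inr (Sum.inr r)))) *
          (if U r then Sum.elim (-Pi.single r 1) (fun _ => u r) else 0 : S ⊕ Unit → ℝ)
            (Sum.inl s) = -β s := by
        rw [Finset.sum_eq_single s]
        · by_cases hs : U s <;> simp [β, hs]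
        · intro r _ hr
          by_cases hs : U r <;> simp [hs, Ne.symm hr]
        · simp
      rw [h₁, h₂] at this
      rw [this]
      simp only [hy, hθ]
      ring
    have hval : ∑ s, (α s * l s - β s * u s) = 1 + τ := by
      have := congrFun hYN (Sum.inr ())
      simp only [N, Matrix.vecMul, dotProduct, Fintype.sum_sum_type, Matrix.fromRows_apply_inl,
        Matrix.fromRows_apply_inr, Matrix.of_apply, Sum.elim_inr,
        Finset.univ_unique, Finset.sum_singleton, mul_zero, Finset.sum_const_zero] at this
      have h₁ : ∑ r, Y (Sum.inr (Sum.inr (Sum.inr (Sum.inl r)))) *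
          (if L r then Sum.elim (Pi.single r 1) (fun _ => -l r) else 0 : S ⊕ Unit → ℝ)
            (Sum.inr ()) = -∑ s, α s * l s := by
        rw [← Finset.sum_neg_distrib]
        refine Finset.sum_congr rfl fun r _ => ?_
        by_cases hs : L r <;> simp [α, hs]
      have h₂ : ∑ r, Y (Sum.inr (Sum.inr (Sum.inr (Sum.inr r)))) *
          (if U r then Sum.elim (-Pi.single r 1) (fun _ => u r) else 0 : S ⊕ Unit → ℝ)
            (Sum.inr ()) = ∑ s, β s * u s := by
        refine Finset.sum_congr rfl fun r _ => ?_
        by_cases hs : U r <;> simp [β, hs]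
      rw [Finset.sum_sub_distrib]
      have h₃ : -1 = 0 + (0 + (τ * 1 + (-∑ s, α s * l s + ∑ s, β s * u s))) := by
        rw [← h₁, ← h₂]
        exact this
      linarith
    have hθ₀ : 0 ≤ θ := hY _
    have hτ₀ : 0 ≤ τ := hY _
    have hα₀ : 0 ≤ ∑ s, α s := Finset.sum_nonneg fun s _ => hα s
    have hβ₀ : 0 ≤ ∑ s, β s := Finset.sum_nonneg fun s _ => hβ s
    have hαs : ∀ s, α s ≤ ∑ s, α s := fun s =>
      Finset.single_le_sum (fun r _ => hα r) (Finset.mem_univ s)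
    have hβs : ∀ s, β s ≤ ∑ s, β s := fun s =>
      Finset.single_le_sum (fun r _ => hβ r) (Finset.mem_univ s)
    -- Dividing by `M` brings `α` and `β` below 1 and keeps the coefficient `1 - M⁻¹ * θ` of `w`
    -- nonnegative, so the perturbed vector is a sum of two elements of the dual cone.
    set M : ℝ := 1 + θ + ∑ s, α s + ∑ s, β s with hM
    have hM₀ : 0 < M := by positivity
    refine ⟨M⁻¹ • α, M⁻¹ • β, fun s => ⟨?_, ?_⟩, fun s => ⟨?_, ?_⟩, fun s hs => ?_, fun s hs => ?_,
      ?_, ?_⟩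
    · exact mul_nonneg (inv_nonneg.2 hM₀.le) (hα s)
    · rw [Pi.smul_apply, smul_eq_mul, inv_mul_le_iff₀ hM₀]
      linarith [hαs s]
    · exact mul_nonneg (inv_nonneg.2 hM₀.le) (hβ s)
    · rw [Pi.smul_apply, smul_eq_mul, inv_mul_le_iff₀ hM₀]
      linarith [hβs s]
    · by_contra hL
      exact hs (by simp [α, hL])
    · by_contra hU
      exact hs (by simp [β, hU])
    · have h₁ : w - M⁻¹ • α + M⁻¹ • β =
          (1 - M⁻¹ * θ) • w + M⁻¹ • (y ᵥ* K.map (Int.cast : ℤ → ℝ)) := by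
        ext s
        have := hcol s
        simp only [Pi.add_apply, Pi.sub_apply, Pi.smul_apply, smul_eq_mul, Matrix.vecMul,
          dotProduct, Matrix.map_apply]
        rw [show ∑ i, y i * (K i s : ℝ) = θ * w s - α s + β s by linarith]
        ring
      rw [h₁]
      refine add_mem_dualCone (smul_mem_dualCone ?_ hw)
        (smul_mem_dualCone (inv_nonneg.2 hM₀.le) ⟨y, fun i => hY _, rfl⟩)
      rw [sub_nonneg, inv_mul_le_iff₀ hM₀]
      linarith
    · have h₁ : ∑ s, ((M⁻¹ • α) s * l s - (M⁻¹ • β) s * u s) =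
          M⁻¹ * ∑ s, (α s * l s - β s * u s) := by
        rw [Finset.mul_sum]
        refine Finset.sum_congr rfl fun s _ => ?_
        simp only [Pi.smul_apply, smul_eq_mul]
        ring
      rw [h₁, hval]
      positivity
  · left
    push Not at h
    obtain ⟨x, hx, hneg⟩ := h
    set t : ℝ := x (Sum.inr ()) with ht
    have ht₀ : 0 < t := by simpa [dotProduct] using hneg
    have hzs : ∀ s, (t⁻¹ • fun s => x (Sum.inl s)) s = t⁻¹ * x (Sum.inl s) := fun s => rfl
    have hK : (fun s => x (Sum.inl s)) ∈ cone K := fun i => by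
      simpa [N, Matrix.mulVec, dotProduct] using hx (Sum.inl i)
    have hcone : (t⁻¹ • fun s => x (Sum.inl s)) ∈ cone K := by
      have : 0 ≤ t⁻¹ • (K.map (Int.cast : ℤ → ℝ) *ᵥ fun s => x (Sum.inl s)) :=
        smul_nonneg (inv_nonneg.2 ht₀.le) hK
      rwa [← Matrix.mulVec_smul] at this
    refine ⟨_, hcone, le_antisymm ?_ (dotProduct_nonneg_of_mem_dualCone hw hcone),
      fun s hs => ?_, fun s hs => ?_⟩
    · have h₁ : ∑ s, w s * x (Sum.inl s) ≤ 0 := by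
        simpa [N, Matrix.mulVec, dotProduct] using hx (Sum.inr (Sum.inl ()))
      rw [dotProduct_smul, smul_eq_mul]
      exact mul_nonpos_of_nonneg_of_nonpos (inv_nonneg.2 ht₀.le) h₁
    · have h₁ := hx (Sum.inr (Sum.inr (Sum.inr (Sum.inl s))))
      simp [N, Matrix.mulVec, dotProduct, hs, Pi.single_apply] at h₁
      rw [hzs, inv_mul_eq_div, le_div_iff₀ ht₀]
      linarith
    · have h₁ := hx (Sum.inr (Sum.inr (Sum.inr (Sum.inr s))))
      simp [N, Matrix.mulVec, dotProduct, hs, Pi.single_apply] at h₁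
      rw [hzs, inv_mul_eq_div, div_le_iff₀ ht₀]
      linarith

/-- The optimality criterion for minimizing a separable discrete convex function over the integral
elements of the dual of a box-TDI cone. -/
theorem exists_isSepFitting_of_forall_sepFun_le [DecidableEq S] {K : Matrix m S ℤ}
    (hK : IsBoxTDI (K.map (Int.cast : ℤ → ℚ)) 0) {φ : S → ℤ → WithTop ℤ}
    (hφ : ∀ s, IsDiscreteConvex (φ s)) {w : S → ℤ} (hw : realVec w ∈ dualCone K)
    (hfin : sepFun φ w ≠ ⊤)
    (hmin : ∀ w' : S → ℤ, realVec w' ∈ dualCone K → sepFun φ w ≤ sepFun φ w') :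
    ∃ z : S → ℤ, realVec z ∈ cone K ∧ w ⬝ᵥ z = 0 ∧ IsSepFitting φ w z := by
  classical
  obtain ⟨a, ha⟩ := exists_eq_coe_of_sepFun_ne_top hfin
  let L : S → Prop := fun s => φ s (w s - 1) ≠ ⊤
  let U : S → Prop := fun s => φ s (w s + 1) ≠ ⊤
  let l : S → ℤ := fun s => a s - (φ s (w s - 1)).untopD 0
  let u : S → ℤ := fun s => (φ s (w s + 1)).untopD 0 - a s
  have hl : ∀ s, L s → φ s (w s - 1) = ((a s - l s : ℤ) : WithTop ℤ) := fun s hs => by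
    rw [show a s - l s = (φ s (w s - 1)).untopD 0 by simp [l]]
    exact coe_untopD hs
  have hu : ∀ s, U s → φ s (w s + 1) = ((a s + u s : ℤ) : WithTop ℤ) := fun s hs => by
    rw [show a s + u s = (φ s (w s + 1)).untopD 0 by simp [u]]
    exact coe_untopD hs
  have hlu : ∀ s, L s → U s → (l s : ℝ) ≤ u s := by
    intro s hL hU
    have := (hφ s).2 (w s) (by rw [ha]; exact WithTop.coe_ne_top)
    rw [ha, hl s hL, hu s hU] at this
    have h₁ : a s + a s ≤ a s - l s + (a s + u s) := by exact_mod_cast this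
    exact_mod_cast (by linarith : l s ≤ u s)
  rcases exists_mem_cone_or_exists_perturbation hw L U (realVec l) (realVec u) with
    ⟨x, hx, hwx, hlx, hxu⟩ | ⟨α, β, hα, hβ, hαL, hβU, hmem, hval⟩
  -- Where a neighbouring value of `φ s` is infinite, the fitting inequality on that side is void;
  -- rounding `x s` outwards merely supplies a finite bound.
  · obtain ⟨z, hz, hfz, hzg, hwz⟩ := exists_integral_mem_cone hK
      (f := fun s => if L s then l s else ⌊x s⌋) (g := fun s => if U s then u s else ⌈x s⌉)
      hw hx (fun s => by
        simp only [realVec]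
        split_ifs with hs
        exacts [hlx s hs, Int.floor_le _]) (fun s => by
        simp only [realVec]
        split_ifs with hs
        exacts [hxu s hs, Int.le_ceil _]) hwx
    rw [realVec_dotProduct, Int.cast_eq_zero] at hwz
    refine ⟨z, hz, hwz, fun s => ⟨by rw [ha]; exact WithTop.coe_ne_top, ?_, ?_⟩⟩
    · by_cases hs : L s
      · have h₁ := hfz s
        simp only [hs, if_true] at h₁
        rw [ha, hl s hs]
        exact_mod_cast (by linarith : a s ≤ z s + (a s - l s))
      · rw [not_not.1 hs, add_top]
        exact le_top
    · by_cases hs : U s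
      · have h₁ := hzg s
        simp only [hs, if_true] at h₁
        rw [ha, hu s hs]
        exact_mod_cast (by linarith : z s + a s ≤ a s + u s)
      · rw [not_not.1 hs]
        exact le_top
  · exfalso
    set d : S → ℝ := β - α with hd
    have hdα : ∀ s, d s < 0 → L s := fun s hs => hαL s fun h => by
      rw [hd, Pi.sub_apply, h] at hs
      linarith [(hβ s).1]
    have hdβ : ∀ s, 0 < d s → U s := fun s hs => hβU s fun h => by
      rw [hd, Pi.sub_apply, h] at hs
      linarith [(hα s).1]
    -- The slope of `φ s` at `w s` on the side to which `d` points. Cancelling the common part of `α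
    -- s` and `β s` only lowers the cost, since left slopes do not exceed right slopes.
    let κ : S → ℝ := fun s => if 0 < d s then u s else if d s < 0 then l s else 0
    have hκ : κ ⬝ᵥ d < 0 := by
      refine lt_of_le_of_lt ?_ (neg_neg_of_pos hval)
      rw [← Finset.sum_neg_distrib]
      refine Finset.sum_le_sum fun s _ => ?_
      have h₁ : ∀ r : ℝ, 0 ≤ r → (r ≠ 0 → α s ≠ 0 ∧ β s ≠ 0) → r * l s ≤ r * u s := by
        intro r hr hr'
        by_cases hr₀ : r = 0
        · simp [hr₀]
        · exact mul_le_mul_of_nonneg_left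
            (hlu s (hαL s (hr' hr₀).1) (hβU s (hr' hr₀).2)) hr
      have hds : d s = β s - α s := rfl
      simp only [κ, realVec]
      split_ifs with hp hn
      · have := h₁ (α s) (hα s).1 fun h => ⟨h, fun h' => by
          rw [hds, h'] at hp
          linarith [(hα s).1]⟩
        rw [hds]
        linarith
      · have := h₁ (β s) (hβ s).1 fun h => ⟨fun h' => by
          rw [hds, h'] at hn
          linarith [(hβ s).1], h⟩
        rw [hds]
        linarith
      · have heq : β s = α s := by linarith
        have := h₁ (α s) (hα s).1 fun h => ⟨h, by rwa [heq]⟩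
        rw [heq]
        linarith
    -- The unit box on the side of `d`: at its integral points Φ is finite and affine with gradient
    -- `κ`, so an integral vertex minimizing `κ` has a smaller Φ than `w`.
    let A : S → ℤ := fun s => w s - if d s < 0 then 1 else 0
    let B : S → ℤ := fun s => w s + if 0 < d s then 1 else 0
    have hX : IsCompact (dualCone K ∩ Set.Icc (realVec A) (realVec B)) :=
      isCompact_Icc.inter_left (isClosed_dualCone K)
    have hwd : realVec w + d ∈ dualCone K ∩ Set.Icc (realVec A) (realVec B) := by
      refine ⟨?_, fun s => ?_, fun s => ?_⟩
      · rwa [hd, ← add_sub_assoc, add_sub_right_comm]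
      · simp only [A, realVec, Pi.add_apply]
        have : -1 ≤ d s := by
          rw [hd, Pi.sub_apply]
          linarith [(hα s).2, (hβ s).1]
        split_ifs <;> push_cast <;> linarith
      · simp only [B, realVec, Pi.add_apply]
        have : d s ≤ 1 := by
          rw [hd, Pi.sub_apply]
          linarith [(hβ s).2, (hα s).1]
        split_ifs <;> push_cast <;> linarith
    obtain ⟨v, hv, hvmin⟩ := exists_extremePoint_forall_dotProduct_le hX ⟨_, hwd⟩ κ
    obtain ⟨v, rfl⟩ := extremePoint_integral_dualCone hK hv
    have hle := hvmin _ hwd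
    rw [dotProduct_add] at hle
    have hstep : ∀ s, ∃ n : ℤ, φ s (v s) = (n : WithTop ℤ) ∧
        (n : ℝ) = a s + κ s * (v s - w s) := by
      intro s
      have hA : A s ≤ v s := Int.cast_le.1 (hv.1.2.1 s)
      have hB : v s ≤ B s := Int.cast_le.1 (hv.1.2.2 s)
      by_cases hvw : v s = w s
      · exact ⟨a s, by rw [hvw, ha], by rw [hvw]; ring⟩
      · by_cases hp : 0 < d s
        · simp only [A, B, hp, not_lt.2 hp.le, if_true, if_false] at hA hB
          have hvs : v s = w s + 1 := by omega
          refine ⟨a s + u s, by rw [hvs, hu s (hdβ s hp)], ?_⟩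
          simp only [κ, hp, if_true, hvs]
          push_cast
          ring
        · by_cases hn : d s < 0
          · simp only [A, B, hp, hn, if_true, if_false] at hA hB
            have hvs : v s = w s - 1 := by omega
            refine ⟨a s - l s, by rw [hvs, hl s (hdα s hn)], ?_⟩
            simp only [κ, hp, hn, if_true, if_false, hvs]
            push_cast
            ring
          · simp only [A, B, hp, hn, if_false] at hA hB
            omega
    choose n hn hnκ using hstep
    have h₁ := hmin v hv.1.1
    rw [sepFun_eq_coe ha, sepFun_eq_coe hn, WithTop.coe_le_coe] at h₁
    have h₂ : ((∑ s, n s : ℤ) : ℝ) = ((∑ s, a s : ℤ) : ℝ) + (κ ⬝ᵥ realVec v - κ ⬝ᵥ realVec w) := by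
      push_cast
      simp only [hnκ, dotProduct, realVec, Finset.sum_add_distrib, mul_sub,
        Finset.sum_sub_distrib]
    have h₃ : ((∑ s, a s : ℤ) : ℝ) ≤ ((∑ s, n s : ℤ) : ℝ) := Int.cast_le.2 h₁
    linarith

end Optimality

/-! ### Weak duality, attainment and the unbounded case -/

section MinMax

variable {m S : Type*} [Fintype m] [Fintype S] {Q : Matrix m S ℤ} {p : m → ℤ} {z₀ : S → ℤ}
  {φ : S → ℤ → WithTop ℤ}

/-- A separable function that is bounded from below by an integer on a set attains its minimum
there. -/
theorem exists_forall_sepFun_le {W : Set (S → ℤ)} (hfeas : ∃ w ∈ W, sepFun φ w ≠ ⊤) {b : ℤ}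
    (hb : ∀ w ∈ W, (b : WithTop ℤ) ≤ sepFun φ w) :
    ∃ w ∈ W, sepFun φ w ≠ ⊤ ∧ ∀ w' ∈ W, sepFun φ w ≤ sepFun φ w' := by
  obtain ⟨n, ⟨w, hw, hwn⟩, hmin⟩ := Int.exists_least_of_bdd
    (P := fun n => ∃ w ∈ W, sepFun φ w = (n : WithTop ℤ))
    ⟨b, fun n ⟨w, hw, hwn⟩ => by
      have := hb w hw
      rw [hwn] at this
      exact_mod_cast this⟩
    (by
      obtain ⟨w, hw, hfin⟩ := hfeas
      obtain ⟨n, hn⟩ := WithTop.ne_top_iff_exists.1 hfin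
      exact ⟨n, w, hw, hn.symm⟩)
  refine ⟨w, hw, by rw [hwn]; exact WithTop.coe_ne_top, fun w' hw' => ?_⟩
  by_cases hfin : sepFun φ w' = ⊤
  · rw [hfin]
    exact le_top
  · obtain ⟨n', hn'⟩ := WithTop.ne_top_iff_exists.1 hfin
    rw [hwn, ← hn']
    exact_mod_cast hmin n' ⟨w', hw', hn'.symm⟩

theorem dotProduct_nonneg_of_mem_tightDualCone {w z : S → ℤ}
    (hw : realVec w ∈ tightDualCone Q p z₀) (hz : realVec z ∈ tightCone Q p z₀) :
    0 ≤ z ⬝ᵥ w := by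
  have := dotProduct_nonneg_of_mem_dualCone hw hz
  rw [realVec_dotProduct, dotProduct_comm] at this
  exact_mod_cast this

/-- Weak duality between the minimization problem and the conjugate problem. -/
theorem conjValues_le_primalValues (hint : IsIntegralPolyhedron (polyhedron Q p))
    (hz₀ : realVec z₀ ∈ polyhedron Q p) {x y : EReal} (hx : x ∈ conjValues Q p z₀ φ)
    (hy : y ∈ primalValues Q p z₀ φ) : x ≤ y := by
  obtain ⟨z, hz, rfl⟩ := hx
  obtain ⟨w, hw, rfl⟩ := hy
  by_cases hfin : sepFun φ w = ⊤
  · rw [hfin, toEReal_top]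
    exact le_top
  · obtain ⟨a, ha⟩ := exists_eq_coe_of_sepFun_ne_top hfin
    refine (neg_sepConj_le ha z).trans ?_
    rw [sepFun_eq_coe ha, toEReal_coe, EReal.coe_le_coe_iff, Int.cast_le]
    linarith [dotProduct_nonneg_of_mem_tightDualCone ((mem_inverseCosts_iff hint hz₀).1 hw) hz]

/-- The value of a fitting pair is a value of the conjugate problem. -/
theorem fittingValues_subset_conjValues (hφ : ∀ s, IsDiscreteConvex (φ s)) :
    fittingValues Q p z₀ φ ⊆ conjValues Q p z₀ φ := by
  rintro _ ⟨⟨w, z⟩, ⟨-, hz, hfit⟩, rfl⟩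
  obtain ⟨a, ha⟩ := hfit.exists_eq_coe
  refine ⟨z, hz, ?_⟩
  rw [neg_sepConj_eq_of_isSepFitting hφ ha hfit]
  dsimp only
  rw [sepFun_eq_coe ha, toEReal_coe, ← EReal.coe_sub, Int.cast_sub]

/-- The bound is Φ(w) - zw: the subgradient inequality at `w` leaves the term zw', which is
nonnegative for every feasible w'. -/
theorem exists_lower_bound_of_fittingPairs_nonempty
    (hint : IsIntegralPolyhedron (polyhedron Q p)) (hz₀ : realVec z₀ ∈ polyhedron Q p)
    (hφ : ∀ s, IsDiscreteConvex (φ s)) (h : (fittingPairs Q p z₀ φ).Nonempty) :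
    ∃ b : ℤ, ∀ w ∈ inverseCosts Q p z₀, (b : WithTop ℤ) ≤ sepFun φ w := by
  obtain ⟨⟨w, z⟩, -, hz, hfit⟩ := h
  obtain ⟨a, ha⟩ := hfit.exists_eq_coe
  refine ⟨(∑ s, a s) - z ⬝ᵥ w, fun w' hw' => le_trans ?_ (hfit.add_dotProduct_le hφ w')⟩
  have := dotProduct_nonneg_of_mem_tightDualCone ((mem_inverseCosts_iff hint hz₀).1 hw') hz
  dsimp only
  rw [sepFun_eq_coe ha]
  exact_mod_cast (by linarith : (∑ s, a s) - z ⬝ᵥ w ≤ ∑ s, a s + (z ⬝ᵥ w' - z ⬝ᵥ w))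

theorem exists_isSepFitting_of_isMinimal [DecidableEq S]
    (hbox : IsBoxTDI (Q.map (Int.cast : ℤ → ℚ)) (fun i => (p i : ℚ)))
    (hint : IsIntegralPolyhedron (polyhedron Q p)) (hz₀ : realVec z₀ ∈ polyhedron Q p)
    (hφ : ∀ s, IsDiscreteConvex (φ s)) {w : S → ℤ} (hw : w ∈ inverseCosts Q p z₀)
    (hfin : sepFun φ w ≠ ⊤) (hmin : ∀ w' ∈ inverseCosts Q p z₀, sepFun φ w ≤ sepFun φ w') :
    ∃ z : S → ℤ, realVec z ∈ tightCone Q p z₀ ∧ w ⬝ᵥ z = 0 ∧ IsSepFitting φ w z :=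
  exists_isSepFitting_of_forall_sepFun_le (isBoxTDI_tightRows hbox hz₀) hφ
    ((mem_inverseCosts_iff hint hz₀).1 hw) hfin
    fun w' hw' => hmin w' ((mem_inverseCosts_iff hint hz₀).2 hw')

/-- In the bounded case, the three optima are attained and have the same integral value. -/
theorem exists_common_optimum [DecidableEq S]
    (hbox : IsBoxTDI (Q.map (Int.cast : ℤ → ℚ)) (fun i => (p i : ℚ)))
    (hint : IsIntegralPolyhedron (polyhedron Q p)) (hz₀ : realVec z₀ ∈ polyhedron Q p)
    (hφ : ∀ s, IsDiscreteConvex (φ s)) (hfeas : ∃ w ∈ inverseCosts Q p z₀, sepFun φ w ≠ ⊤)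
    (hbdd : ∃ b : ℤ, ∀ w ∈ inverseCosts Q p z₀, (b : WithTop ℤ) ≤ sepFun φ w) :
    ∃ μ : ℤ, IsLeast (primalValues Q p z₀ φ) ((μ : ℝ) : EReal) ∧
      IsGreatest (fittingValues Q p z₀ φ) ((μ : ℝ) : EReal) ∧
      IsGreatest (conjValues Q p z₀ φ) ((μ : ℝ) : EReal) := by
  obtain ⟨b, hb⟩ := hbdd
  obtain ⟨w, hw, hfin, hmin⟩ := exists_forall_sepFun_le hfeas hb
  obtain ⟨z, hz, hwz, hfit⟩ := exists_isSepFitting_of_isMinimal hbox hint hz₀ hφ hw hfin hmin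
  obtain ⟨a, ha⟩ := hfit.exists_eq_coe
  have hprimal : (((∑ s, a s : ℤ) : ℝ) : EReal) ∈ primalValues Q p z₀ φ :=
    ⟨w, hw, by rw [sepFun_eq_coe ha, toEReal_coe]⟩
  have hfitting : (((∑ s, a s : ℤ) : ℝ) : EReal) ∈ fittingValues Q p z₀ φ := by
    refine ⟨(w, z), ⟨(mem_inverseCosts_iff hint hz₀).1 hw, hz, hfit⟩, ?_⟩
    dsimp only
    rw [sepFun_eq_coe ha, toEReal_coe, dotProduct_comm, hwz, Int.cast_zero, EReal.coe_zero,
      sub_zero]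
  have hconj := fittingValues_subset_conjValues hφ hfitting
  exact ⟨∑ s, a s, ⟨hprimal, fun y hy => conjValues_le_primalValues hint hz₀ hconj hy⟩,
    ⟨hfitting, fun x hx => conjValues_le_primalValues hint hz₀
      (fittingValues_subset_conjValues hφ hx) hprimal⟩,
    ⟨hconj, fun x hx => conjValues_le_primalValues hint hz₀ hx hprimal⟩⟩

theorem sInf_primalValues_eq_bot
    (h : ¬∃ b : ℤ, ∀ w ∈ inverseCosts Q p z₀, (b : WithTop ℤ) ≤ sepFun φ w) :
    sInf (primalValues Q p z₀ φ) = ⊥ := by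
  rw [EReal.eq_bot_iff_forall_lt]
  intro r
  push Not at h
  -- Bounds are integers here, so the real level `r` is replaced by its floor.
  obtain ⟨w, hw, hlt⟩ := h ⌊r⌋
  have hmem : toEReal (sepFun φ w) ∈ primalValues Q p z₀ φ := ⟨w, hw, rfl⟩
  refine (sInf_le hmem).trans_lt ?_
  obtain ⟨n, hn⟩ := WithTop.ne_top_iff_exists.1 (hlt.trans (WithTop.coe_lt_top _)).ne
  rw [← hn] at hlt ⊢
  rw [toEReal_coe, EReal.coe_lt_coe_iff]
  exact (Int.cast_lt.2 (WithTop.coe_lt_coe.1 hlt)).trans_le (Int.floor_le r)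

end MinMax

end BoxTDI

/-! ### The min-max theorem -/

theorem theorem6p1 {m S : Type*} [Fintype m] [Fintype S] [DecidableEq S]
    (Q : Matrix m S ℤ) (p : m → ℤ)
    (hbox : IsBoxTDI (Q.map (Int.cast : ℤ → ℚ)) (fun i => (p i : ℚ)))
    (hint : IsIntegralPolyhedron (polyhedron Q p))
    (z₀ : S → ℤ) (hz₀ : realVec z₀ ∈ polyhedron Q p)
    (φ : S → ℤ → WithTop ℤ) (hφ : ∀ s, IsDiscreteConvex (φ s))
    (hfeas : ∃ w ∈ inverseCosts Q p z₀, sepFun φ w ≠ ⊤) :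
    -- the min-max formula with values in the extended reals
    (sInf (primalValues Q p z₀ φ) = sSup (fittingValues Q p z₀ φ) ∧
      sInf (primalValues Q p z₀ φ) = sSup (conjValues Q p z₀ φ)) ∧
    -- lower boundedness is equivalent to the existence of a fitting pair
    ((∃ b : ℤ, ∀ w ∈ inverseCosts Q p z₀, (b : WithTop ℤ) ≤ sepFun φ w) ↔
      (fittingPairs Q p z₀ φ).Nonempty) ∧
    -- in the bounded case all three optima are attained, with the same integer as value
    ((∃ b : ℤ, ∀ w ∈ inverseCosts Q p z₀, (b : WithTop ℤ) ≤ sepFun φ w) →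
      ∃ μ : ℤ, IsLeast (primalValues Q p z₀ φ) ((μ : ℝ) : EReal) ∧
        IsGreatest (fittingValues Q p z₀ φ) ((μ : ℝ) : EReal) ∧
        IsGreatest (conjValues Q p z₀ φ) ((μ : ℝ) : EReal)) ∧
    -- the optimality criterion
    (∀ w' : S → ℤ, IsMinimizer (realVec w') (polyhedron Q p) (realVec z₀) →
      ((∀ w ∈ inverseCosts Q p z₀, sepFun φ w' ≤ sepFun φ w) ↔
        ∃ z' : S → ℤ, realVec z' ∈ tightCone Q p z₀ ∧ w' ⬝ᵥ z' = 0 ∧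
          IsSepFitting φ w' z')) := by
  have hiff : (∃ b : ℤ, ∀ w ∈ inverseCosts Q p z₀, (b : WithTop ℤ) ≤ sepFun φ w) ↔
      (fittingPairs Q p z₀ φ).Nonempty := by
    refine ⟨fun h => ?_, exists_lower_bound_of_fittingPairs_nonempty hint hz₀ hφ⟩
    obtain ⟨μ, -, ⟨⟨wz, hwz, -⟩, -⟩, -⟩ := exists_common_optimum hbox hint hz₀ hφ hfeas h
    exact ⟨wz, hwz⟩
  refine ⟨?_, hiff, exists_common_optimum hbox hint hz₀ hφ hfeas, fun w' hw' => ?_⟩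
  · by_cases h : ∃ b : ℤ, ∀ w ∈ inverseCosts Q p z₀, (b : WithTop ℤ) ≤ sepFun φ w
    · obtain ⟨μ, h₁, h₂, h₃⟩ := exists_common_optimum hbox hint hz₀ hφ hfeas h
      rw [h₁.csInf_eq, h₂.csSup_eq, h₃.csSup_eq]
      exact ⟨rfl, rfl⟩
    · have hbot := sInf_primalValues_eq_bot h
      -- Weak duality puts the conjugate supremum below an infimum equal to -∞; the values of
      -- fitting pairs are among the conjugate values.
      have hle : sSup (conjValues Q p z₀ φ) ≤ ⊥ := by
        rw [← hbot]
        exact sSup_le fun x hx => le_sInf fun y hy => conjValues_le_primalValues hint hz₀ hx hy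
      rw [hbot, eq_comm, eq_comm (a := ⊥), ← le_bot_iff, ← le_bot_iff]
      exact ⟨(sSup_le_sSup (fittingValues_subset_conjValues hφ)).trans hle, hle⟩
  · have hw : w' ∈ inverseCosts Q p z₀ :=
      (mem_inverseCosts_iff hint hz₀).2 (mem_tightDualCone_of_isMinimizer hz₀ hw')
    constructor
    · intro hmin
      obtain ⟨w, hwI, hfin⟩ := hfeas
      -- A minimizer has finite value because some feasible vector does.
      exact exists_isSepFitting_of_isMinimal hbox hint hz₀ hφ hw
        ((hmin w hwI).trans_lt (lt_top_iff_ne_top.2 hfin)).ne hmin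
    · rintro ⟨z, hz, hwz, hfit⟩ w hwI
      have h₁ := dotProduct_nonneg_of_mem_tightDualCone ((mem_inverseCosts_iff hint hz₀).1 hwI) hz
      refine le_trans ?_ (hfit.add_dotProduct_le hφ w)
      rw [dotProduct_comm z w', hwz, sub_zero]
      exact le_add_of_nonneg_right (by exact_mod_cast h₁)
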